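/- Let $d\ge 1$, let $\Omega\subset\mathbb R^d$ be a bounded polygonal (polyhedral) domain which is the interior of its closure (no slits), let $k\ge 0$ be an integer, $1<p<\infty$, and let $\sigma>0$ and $\tau$ be real constants. A mesh $\mathcal T$ of $\Omega$ is a finite, numbered family of convex polytopes with nonempty, pairwise disjoint interiors whose union is $\overline\Omega$ (simplicial meshes are included; hanging nodes are allowed). With $h_T=\operatorname{diam}T$, it is shape regular with constant $\sigma$ if each $T\in\mathcal T$ contains a closed ball of radius $\sigma h_T$, and quasi-uniform with constant $\tau$ if $h_T\le\tau h_{T'}$ for all $T,T'\in\mathcal T$. The interior edges (faces) $\mathcal E^I$ are the sets $e=\partial T^+\cap\partial T^-$ of positive $(d-1)$-dimensional measure, where $T^+\ne T^-$ are elements and $T^+$ has the smaller number; $\nu_e$ is the unit normal to $e$ pointing from $T^+$ to $T^-$, and $[v]=v^+-v^-$, $\{v\}=\tfrac12(v^++v^-)$ on $e$, where $v^\pm$ are the traces from $T^\pm$. Set $h_e=\operatorname{diam}e$ if $d\ge2$ and $h_e=\max(h_{T^+},h_{T^-})$ if $d=1$. The boundary edges $\mathcal E^B$ are the flat pieces of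 $\partial T\cap\partial\Omega$, $T\in\mathcal T$; there $\nu_e$ is the outward unit normal and $[v]$ is the trace of $v$. Put $\mathcal E=\mathcal E^I\cup\mathcal E^B$. Let $V_h$ be the space of functions whose restriction to each $T\in\mathcal T$ is a polynomial of total degree at most $k$, without continuity between elements. For $v\in V_h$ and $l=1,\dots,d$ let $\partial^{\pm}_{h,x_l}v\in V_h$ be the unique elements with $$\int_\Omega \partial^{\pm}_{h,x_l}(v)\,\varphi\,dx=\sum_{e\in\mathcal E}\int_e \mathcal Q_l^{\pm}(v)\,\nu_e^l\,[\varphi]\,dS-\sum_{T\in\mathcal T}\int_T v\,\partial_{x_l}\varphi\,dx\qquad\forall\varphi\in V_h,$$ where $\mathcal Q_l^\pm(v)=\{v\}\pm\tfrac12\operatorname{sgn}(\nu_e^l)[v]$ on interior edges ($\operatorname{sgn}(\xi)=1$ if $\xi\ge0$, and $-1$ otherwise) and $\mathcal Q_l^\pm(v)=v$ on boundary edges. The DG-FE numerical gradient $\nabla_hv$ has the components $\tfrac12(\partial^+_{h,x_l}v+\partial^-_{h,x_l}v)$. For a piecewise defined vector field $G$ put $\|G\|_{L^p(\mathcal T)}=\big(\sum_{T}\int_T|G|^p\,dx\big)^{1/p}$.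 For penalty parameters $\gamma_e$, $e\in\mathcal E^I$, put $$|v|_{W^{1,p}(\mathcal T)}=\|\nabla v\|_{L^p(\mathcal T)}+\Big(\sum_{e\in\mathcal E^I}\int_e\gamma_eh_e^{1-p}|[v]|^p\,dS\Big)^{1/p},$$ where $\nabla v$ is the piecewise gradient. Then there exist constants $C>0$ and $\gamma^*>0$, depending only on $d,k,p,\Omega,\sigma,\tau$ and in particular not on the mesh size, such that for every mesh $\mathcal T$ of $\Omega$ that is shape regular with constant $\sigma$ and quasi-uniform with constant $\tau$, for all $\gamma_e>\gamma^*$ $(e\in\mathcal E^I)$ and all $v\in V_h$, $$|v|_{W^{1,p}(\mathcal T)}\le C\,\|\nabla_hv\|_{L^p(\mathcal T)}+C\Big(\sum_{e\in\mathcal E^I}\gamma_eh_e^{1-p}\|[v]\|_{L^p(e)}^p\Big)^{1/p}.$$ -/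

import Mathlib

open MeasureTheory Set
open scoped RealInnerProductSpace

noncomputable section

namespace DGCalc

/-- Points of `ℝᵈ` with the Euclidean norm. -/
abbrev E (d : ℕ) := EuclideanSpace ℝ (Fin d)

/-- The surface measure `dS` in `ℝᵈ`: the `(d-1)`-dimensional Hausdorff measure, normalized so that
it is Lebesgue measure on hyperplanes (counting measure for `d = 1`). -/
def surface (d : ℕ) : Measure (E d) := Measure.euclideanHausdorffMeasure (d - 1)

/-! ### Polytopes, domains, meshes -/

/-- A convex polytope: a bounded intersection of finitely many half-spaces `⟪a, x⟫ ≤ b`,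
each recorded as a pair `(a, b)` with unit normal `a`. -/
structure ConvexPolytope (d : ℕ) where
  halfSpaces : Finset (E d × ℝ)
  norm_eq_one : ∀ H ∈ halfSpaces, ‖H.1‖ = 1
  isBounded : Bornology.IsBounded {x : E d | ∀ H ∈ halfSpaces, ⟪H.1, x⟫ ≤ H.2}

namespace ConvexPolytope

variable {d : ℕ}

/-- The set of points of the polytope. -/
def carrier (T : ConvexPolytope d) : Set (E d) := {x | ∀ H ∈ T.halfSpaces, ⟪H.1, x⟫ ≤ H.2}

/-- The facet of `T` on the hyperplane `⟪a, x⟫ = b`, where `H = (a, b)`; the outward unit normal of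
`T` on it is `a`. (A redundant half-space gives an empty or lower dimensional set, which has surface
measure zero.) -/
def facet (T : ConvexPolytope d) (H : E d × ℝ) : Set (E d) := {x ∈ T.carrier | ⟪H.1, x⟫ = H.2}

theorem isCompact_carrier (T : ConvexPolytope d) : IsCompact T.carrier := by
  refine Metric.isCompact_of_isClosed_isBounded ?_ T.isBounded
  have : T.carrier = ⋂ H ∈ T.halfSpaces, {x : E d | ⟪H.1, x⟫ ≤ H.2} := by
    ext x; simp [carrier]
  rw [this]
  exact isClosed_biInter fun H _ => isClosed_le (by fun_prop) continuous_const

theorem convex_carrier (T : ConvexPolytope d) : Convex ℝ T.carrier := by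
  have : T.carrier = ⋂ H ∈ T.halfSpaces, {x : E d | ⟪H.1, x⟫ ≤ H.2} := by
    ext x; simp [carrier]
  rw [this]
  refine convex_iInter₂ fun H _ => ?_
  exact convex_halfSpace_le (𝕜 := ℝ) (f := fun x : E d => ⟪H.1, x⟫)
    ⟨fun x y => inner_add_right _ _ _, fun c x => by simp [inner_smul_right]⟩ _

theorem isCompact_facet (T : ConvexPolytope d) (H : E d × ℝ) : IsCompact (T.facet H) :=
  T.isCompact_carrier.inter_right (isClosed_eq (by fun_prop) continuous_const)

end ConvexPolytope

/-- A bounded polygonal (polyhedral) domain: a bounded, open, connected, nonempty set without slits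
whose closure is a finite union of convex polytopes. -/
structure IsPolygonalDomain {d : ℕ} (Ω : Set (E d)) : Prop where
  isOpen : IsOpen Ω
  isConnected : IsConnected Ω
  isBounded : Bornology.IsBounded Ω
  interior_closure : interior (closure Ω) = Ω
  polygonal : ∃ (n : ℕ) (P : Fin n → ConvexPolytope d), closure Ω = ⋃ i, (P i).carrier

/-- A mesh of `Ω`: finitely many convex polytopes with nonempty, pairwise disjoint interiors that
cover the closure of `Ω`. The order of `Fin n` is the global numbering of the elements. -/
structure Mesh {d : ℕ} (Ω : Set (E d)) where
  n : ℕ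
  elem : Fin n → ConvexPolytope d
  interior_nonempty : ∀ i, (interior (elem i).carrier).Nonempty
  disjoint : ∀ i j, i ≠ j → Disjoint (interior (elem i).carrier) (interior (elem j).carrier)
  cover : ⋃ i, (elem i).carrier = closure Ω

namespace Mesh

variable {d : ℕ} {Ω : Set (E d)} (M : Mesh Ω)

/-- The element `T_i` as a set. -/
def T (i : Fin M.n) : Set (E d) := (M.elem i).carrier

/-- The diameter `h_T` of an element. -/
def hT (i : Fin M.n) : ℝ := Metric.diam (M.T i)

/-- Shape regularity with constant `σ`: each element contains a ball of radius `σ h_T`. -/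
def ShapeRegular (σ : ℝ) : Prop := ∀ i, ∃ x, Metric.closedBall x (σ * M.hT i) ⊆ M.T i

/-- Quasi-uniformity with constant `τ`: any two element diameters differ by a factor at most `τ`. -/
def QuasiUniform (τ : ℝ) : Prop := ∀ i j, M.hT i ≤ τ * M.hT j

/-- The set `∂T_i ∩ ∂T_j` for a pair of different elements; as the interiors are disjoint this is
`T_i ∩ T_j`. -/
def edge (e : Fin M.n × Fin M.n) : Set (E d) := M.T e.1 ∩ M.T e.2

open Classical in
/-- The interior edges/faces: the pairs `e = (T⁺, T⁻)`, `T⁺` having the smaller index, that share a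
`(d-1)`-dimensional piece of boundary. -/
def interiorEdges : Finset (Fin M.n × Fin M.n) :=
  Finset.univ.filter fun e => e.1 < e.2 ∧ 0 < surface d (M.edge e)

/-- The size `h_e` of an edge/face: its diameter if `d ≥ 2`; for `d = 1` an edge is a point, and
`h_e` is the larger length of the two adjacent intervals. -/
def hEdge (e : Fin M.n × Fin M.n) : ℝ :=
  if d = 1 then max (M.hT e.1) (M.hT e.2) else Metric.diam (M.edge e)

theorem exists_edgeNormal (e : Fin M.n × Fin M.n) (h : e.1 ≠ e.2) :
    ∃ ν : E d, ‖ν‖ = 1 ∧ ∀ x ∈ M.T e.1, ∀ y ∈ M.T e.2, ⟪ν, x⟫ ≤ ⟪ν, y⟫ := by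
  have c1 := (M.elem e.1).convex_carrier
  have c2 := (M.elem e.2).convex_carrier
  have k1 := (M.elem e.1).isCompact_carrier.isClosed
  have k2 := (M.elem e.2).isCompact_carrier.isClosed
  obtain ⟨f, u, hf1, hf2⟩ := geometric_hahn_banach_open_open c1.interior isOpen_interior
    c2.interior isOpen_interior (M.disjoint _ _ h)
  set w := (InnerProductSpace.toDual ℝ (E d)).symm f with hw
  have hfw : ∀ x, f x = ⟪w, x⟫ := fun x => by
    rw [hw, InnerProductSpace.toDual_symm_apply]
  have hw0 : w ≠ 0 := by
    intro h0
    obtain ⟨x, hx⟩ := M.interior_nonempty e.1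
    obtain ⟨y, hy⟩ := M.interior_nonempty e.2
    have a := hf1 x hx
    have b := hf2 y hy
    rw [hfw, h0, inner_zero_left] at a b
    linarith
  have e1 : ∀ x ∈ M.T e.1, f x ≤ u := by
    intro x hx
    have hcl : x ∈ closure (interior (M.elem e.1).carrier) := by
      rw [c1.closure_interior_eq_closure_of_nonempty_interior (M.interior_nonempty _),
        k1.closure_eq]
      exact hx
    exact closure_minimal (fun y hy => (hf1 y hy).le)
      (isClosed_le f.continuous continuous_const) hcl
  have e2 : ∀ x ∈ M.T e.2, u ≤ f x := by
    intro x hx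
    have hcl : x ∈ closure (interior (M.elem e.2).carrier) := by
      rw [c2.closure_interior_eq_closure_of_nonempty_interior (M.interior_nonempty _),
        k2.closure_eq]
      exact hx
    exact closure_minimal (fun y hy => (hf2 y hy).le)
      (isClosed_le continuous_const f.continuous) hcl
  refine ⟨‖w‖⁻¹ • w, norm_smul_inv_norm (𝕜 := ℝ) hw0, fun x hx y hy => ?_⟩
  rw [real_inner_smul_left, real_inner_smul_left, ← hfw, ← hfw]
  exact mul_le_mul_of_nonneg_left ((e1 x hx).trans (e2 y hy)) (by positivity)

open Classical in
/-- The unit normal `ν_e` to an interior edge/face, pointing out of `T⁺` into `T⁻`: the unit vector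
separating the two elements (unique, because `e` is `(d-1)`-dimensional). -/
def edgeNormal (e : Fin M.n × Fin M.n) : E d :=
  if h : e.1 ≠ e.2 then (M.exists_edgeNormal e h).choose else 0

/-- The piece of the boundary of `Ω` on the facet of `T_i` with hyperplane `H`. Taken over all
elements `i` and all their facets `H`, the pieces of positive surface measure are the boundary
edges/faces; the outward unit normal of `Ω` on such a piece is `H.1`. -/
def bdryEdge (i : Fin M.n) (H : E d × ℝ) : Set (E d) := (M.elem i).facet H ∩ frontier Ω

/-! ### The discontinuous Galerkin space -/

/-- The space `V_h` of piecewise polynomials of total degree at most `k`: one polynomial per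
element, with no continuity between elements. -/
abbrev DGSpace (k : ℕ) := Fin M.n → MvPolynomial.restrictTotalDegree (Fin d) ℝ k

variable {M} {k : ℕ}

/-- The value at `x` of the restriction of `v` to the element `T_i`; for `x ∈ ∂T_i` this is the
trace of `v` from `T_i`. -/
def val (v : M.DGSpace k) (i : Fin M.n) (x : E d) : ℝ :=
  MvPolynomial.eval (fun l => x l) (v i : MvPolynomial (Fin d) ℝ)

/-- The partial derivative in the `l`-th coordinate of the restriction of `v` to `T_i`. -/
def dval (l : Fin d) (v : M.DGSpace k) (i : Fin M.n) (x : E d) : ℝ :=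
  MvPolynomial.eval (fun m => x m) (MvPolynomial.pderiv l (v i : MvPolynomial (Fin d) ℝ))

/-- The piecewise gradient `∇v` on `T_i`. -/
def pwGrad (v : M.DGSpace k) (i : Fin M.n) (x : E d) : E d :=
  WithLp.toLp 2 fun l => dval l v i x

/-- The jump `[v] = v⁺ - v⁻` on an interior edge. -/
def jump (v : M.DGSpace k) (e : Fin M.n × Fin M.n) (x : E d) : ℝ := val v e.1 x - val v e.2 x

/-- The average `{v} = (v⁺ + v⁻) / 2` on an interior edge. -/
def avg (v : M.DGSpace k) (e : Fin M.n × Fin M.n) (x : E d) : ℝ :=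
  (val v e.1 x + val v e.2 x) / 2

/-- The sign function with `sgn 0 = 1`. -/
def sgn (ξ : ℝ) : ℝ := if 0 ≤ ξ then 1 else -1

/-- The trace operators `Q_l^± v = {v} ± (1/2) sgn(ν_e^l) [v]` on an interior edge, with `s = 1` for
the sign `+` and `s = -1` for the sign `-`. -/
def traceOp (s : ℝ) (l : Fin d) (v : M.DGSpace k) (e : Fin M.n × Fin M.n) (x : E d) : ℝ :=
  avg v e x + s * (1 / 2) * sgn (M.edgeNormal e l) * jump v e x

/-! ### The DG-FE numerical derivatives -/

/-- `∫_Ω u φ` for `u, φ ∈ V_h`. -/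
def massForm (u φ : M.DGSpace k) : ℝ := ∑ i, ∫ x in M.T i, val u i x * val φ i x

/-- The right-hand side of the definition of the numerical derivative `∂_{h,x_l}^±`:
`∑_e ∫_e Q_l^±(v) ν_e^l [φ] dS - ∑_T ∫_T v ∂_l φ dx`, the first sum being over all interior and
boundary edges, where `Q_l^± v = v` and `[φ] = φ` on a boundary edge. -/
def numDerivRHS (s : ℝ) (l : Fin d) (v φ : M.DGSpace k) : ℝ :=
  (∑ e ∈ M.interiorEdges,
      ∫ x in M.edge e, traceOp s l v e x * M.edgeNormal e l * jump φ e x ∂(surface d))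
    + (∑ i, ∑ H ∈ (M.elem i).halfSpaces,
      ∫ x in M.bdryEdge i H, val v i x * H.1 l * val φ i x ∂(surface d))
    - ∑ i, ∫ x in M.T i, val v i x * dval l φ i x

theorem surface_lt_top {K : Set (E d)} (hK : Bornology.IsBounded K) {a : E d} (ha : ‖a‖ = 1)
    (hflat : ∀ x ∈ K, ∀ y ∈ K, ⟪a, x⟫ = ⟪a, y⟫) : surface d K < ⊤ := by
  rcases K.eq_empty_or_nonempty with rfl | ⟨x₀, hx₀⟩
  · simp
  have ha0 : a ≠ 0 := by
    rintro rfl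
    simp at ha
  have hd : d - 1 + 1 = d := by
    rcases d with _ | d
    · exact absurd (Subsingleton.elim a 0) ha0
    · rfl
  have hfin : Module.finrank ℝ (ℝ ∙ a)ᗮ = d - 1 := by
    have : Fact (Module.finrank ℝ (E d) = d - 1 + 1) := ⟨by simp [hd]⟩
    exact Submodule.finrank_orthogonal_span_singleton ha0
  let f : (ℝ ∙ a)ᗮ → E d := fun w => x₀ + (w : E d)
  have hf : Isometry f := (isometry_add_left x₀).comp isometry_subtype_coe
  have himg : f '' (f ⁻¹' K) = K := by
    rw [image_preimage_eq_iff]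
    intro x hx
    refine ⟨⟨x - x₀, ?_⟩, by simp [f]⟩
    rw [Submodule.mem_orthogonal_singleton_iff_inner_right, inner_sub_right,
      hflat x hx x₀ hx₀, sub_self]
  rw [← himg, surface, hf.euclideanHausdorffMeasure_image, ← hfin]
  exact (hf.antilipschitz.isBounded_preimage hK).measure_lt_top

theorem integrableOn_of_compact {μ : Measure (E d)} {K : Set (E d)} (hK : IsCompact K)
    (hμ : μ K < ⊤) {g : E d → ℝ} (hg : Continuous g) : IntegrableOn g K μ := by
  obtain ⟨C, hC⟩ := hK.exists_bound_of_continuousOn hg.continuousOn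
  exact Measure.integrableOn_of_bounded hμ.ne hg.aestronglyMeasurable
    (ae_restrict_of_forall_mem hK.measurableSet hC)

@[fun_prop]
theorem continuous_val (v : M.DGSpace k) (i : Fin M.n) : Continuous (val v i) := by
  unfold val
  exact (MvPolynomial.continuous_eval _).comp (by fun_prop)

@[fun_prop]
theorem continuous_dval (l : Fin d) (v : M.DGSpace k) (i : Fin M.n) : Continuous (dval l v i) := by
  unfold dval
  exact (MvPolynomial.continuous_eval _).comp (by fun_prop)

@[fun_prop]
theorem continuous_jump (v : M.DGSpace k) (e : Fin M.n × Fin M.n) : Continuous (jump v e) := by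
  unfold jump
  fun_prop

@[fun_prop]
theorem continuous_traceOp (s : ℝ) (l : Fin d) (v : M.DGSpace k) (e : Fin M.n × Fin M.n) :
    Continuous (traceOp s l v e) := by
  unfold traceOp avg
  fun_prop

theorem val_add (u v : M.DGSpace k) (i : Fin M.n) (x : E d) :
    val (u + v) i x = val u i x + val v i x := by simp [val]

theorem val_smul (c : ℝ) (v : M.DGSpace k) (i : Fin M.n) (x : E d) :
    val (c • v) i x = c * val v i x := by simp [val]

theorem dval_add (l : Fin d) (u v : M.DGSpace k) (i : Fin M.n) (x : E d) :
    dval l (u + v) i x = dval l u i x + dval l v i x := by simp [dval]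

theorem dval_smul (l : Fin d) (c : ℝ) (v : M.DGSpace k) (i : Fin M.n) (x : E d) :
    dval l (c • v) i x = c * dval l v i x := by simp [dval]

theorem jump_add (u v : M.DGSpace k) (e : Fin M.n × Fin M.n) (x : E d) :
    jump (u + v) e x = jump u e x + jump v e x := by simp only [jump, val_add]; ring

theorem jump_smul (c : ℝ) (v : M.DGSpace k) (e : Fin M.n × Fin M.n) (x : E d) :
    jump (c • v) e x = c * jump v e x := by simp only [jump, val_smul]; ring

theorem isCompact_T (i : Fin M.n) : IsCompact (M.T i) := (M.elem i).isCompact_carrier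

theorem integrableOn_T (i : Fin M.n) {g : E d → ℝ} (hg : Continuous g) :
    IntegrableOn g (M.T i) :=
  integrableOn_of_compact (isCompact_T i) (isCompact_T i).measure_lt_top hg

theorem integrableOn_edge (e : Fin M.n × Fin M.n) (he : e ∈ M.interiorEdges) {g : E d → ℝ}
    (hg : Continuous g) : IntegrableOn g (M.edge e) (surface d) := by
  have hne : e.1 ≠ e.2 := by
    simp only [interiorEdges, Finset.mem_filter] at he
    exact he.2.1.ne
  obtain ⟨ν, hν, hs⟩ := M.exists_edgeNormal e hne
  have hK : IsCompact (M.edge e) := (isCompact_T e.1).inter (isCompact_T e.2)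
  exact integrableOn_of_compact hK (surface_lt_top hK.isBounded hν fun x hx y hy =>
    le_antisymm (hs x hx.1 y hy.2) (hs y hy.1 x hx.2)) hg

theorem integrableOn_bdryEdge (i : Fin M.n) (H : E d × ℝ) (hH : H ∈ (M.elem i).halfSpaces)
    {g : E d → ℝ} (hg : Continuous g) : IntegrableOn g (M.bdryEdge i H) (surface d) := by
  have hK : IsCompact (M.bdryEdge i H) :=
    ((M.elem i).isCompact_facet H).inter_right isClosed_frontier
  exact integrableOn_of_compact hK (surface_lt_top hK.isBounded
    ((M.elem i).norm_eq_one H hH) fun x hx y hy => hx.1.2.trans hy.1.2.symm) hg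

theorem numDerivRHS_add (s : ℝ) (l : Fin d) (v φ ψ : M.DGSpace k) :
    numDerivRHS s l v (φ + ψ) = numDerivRHS s l v φ + numDerivRHS s l v ψ := by
  have h1 : ∀ e ∈ M.interiorEdges,
      ∫ x in M.edge e, traceOp s l v e x * M.edgeNormal e l * jump (φ + ψ) e x ∂(surface d)
      = (∫ x in M.edge e, traceOp s l v e x * M.edgeNormal e l * jump φ e x ∂(surface d))
      + ∫ x in M.edge e, traceOp s l v e x * M.edgeNormal e l * jump ψ e x ∂(surface d) := by
    intro e he
    simp only [jump_add, mul_add]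
    exact integral_add (integrableOn_edge e he (by fun_prop)) (integrableOn_edge e he (by fun_prop))
  have h2 : ∀ i, ∀ H ∈ (M.elem i).halfSpaces,
      ∫ x in M.bdryEdge i H, val v i x * H.1 l * val (φ + ψ) i x ∂(surface d)
      = (∫ x in M.bdryEdge i H, val v i x * H.1 l * val φ i x ∂(surface d))
      + ∫ x in M.bdryEdge i H, val v i x * H.1 l * val ψ i x ∂(surface d) := by
    intro i H hH
    simp only [val_add, mul_add]
    exact integral_add (integrableOn_bdryEdge i H hH (by fun_prop))
      (integrableOn_bdryEdge i H hH (by fun_prop))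
  have h3 : ∀ i, ∫ x in M.T i, val v i x * dval l (φ + ψ) i x
      = (∫ x in M.T i, val v i x * dval l φ i x) + ∫ x in M.T i, val v i x * dval l ψ i x := by
    intro i
    simp only [dval_add, mul_add]
    exact integral_add (integrableOn_T i (by fun_prop)) (integrableOn_T i (by fun_prop))
  unfold numDerivRHS
  rw [Finset.sum_congr rfl h1, Finset.sum_congr rfl fun i _ => Finset.sum_congr rfl (h2 i),
    Finset.sum_congr rfl fun i _ => h3 i]
  simp only [Finset.sum_add_distrib]
  ring

theorem numDerivRHS_smul (s : ℝ) (l : Fin d) (v : M.DGSpace k) (c : ℝ) (φ : M.DGSpace k) :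
    numDerivRHS s l v (c • φ) = c * numDerivRHS s l v φ := by
  unfold numDerivRHS
  simp only [jump_smul, val_smul, dval_smul, mul_left_comm _ c, integral_const_mul,
    ← Finset.mul_sum]
  ring

theorem massForm_add_left (u v φ : M.DGSpace k) :
    massForm (u + v) φ = massForm u φ + massForm v φ := by
  unfold massForm
  rw [← Finset.sum_add_distrib]
  refine Finset.sum_congr rfl fun i _ => ?_
  simp only [val_add, add_mul]
  exact integral_add (integrableOn_T i (by fun_prop)) (integrableOn_T i (by fun_prop))

theorem massForm_comm (u φ : M.DGSpace k) : massForm u φ = massForm φ u := by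
  simp only [massForm, mul_comm]

theorem massForm_smul_left (c : ℝ) (u φ : M.DGSpace k) :
    massForm (c • u) φ = c * massForm u φ := by
  simp only [massForm, val_smul, mul_assoc, integral_const_mul, ← Finset.mul_sum]

theorem eq_zero_of_massForm_self (u : M.DGSpace k) (h : massForm u u = 0) : u = 0 := by
  funext i
  have h0 : ∫ x in M.T i, val u i x * val u i x = 0 :=
    (Finset.sum_eq_zero_iff_of_nonneg fun j _ =>
      integral_nonneg fun x => mul_self_nonneg (val u j x)).1 h i (Finset.mem_univ i)
  rw [setIntegral_eq_zero_iff_of_nonneg_ae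
    (Filter.Eventually.of_forall fun x => mul_self_nonneg (val u i x))
    (integrableOn_T i (by fun_prop))] at h0
  have hz : ∀ x ∈ interior (M.T i), val u i x = 0 := by
    have h1 : (fun x => val u i x * val u i x) =ᵐ[volume.restrict (interior (M.T i))] 0 :=
      ae_restrict_of_ae_restrict_of_subset interior_subset h0
    have h2 := Measure.eqOn_open_of_ae_eq h1 isOpen_interior
      (by fun_prop) (by fun_prop)
    intro x hx
    exact mul_self_eq_zero.1 (h2 hx)
  obtain ⟨c, hc⟩ := M.interior_nonempty i
  obtain ⟨r, hr, hball⟩ : ∃ r > 0, Set.pi univ (fun l => Metric.ball (c l) r) ⊆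
      {y : Fin d → ℝ | WithLp.toLp 2 y ∈ interior (M.T i)} := by
    have hopen : IsOpen {y : Fin d → ℝ | WithLp.toLp 2 y ∈ interior (M.T i)} :=
      isOpen_interior.preimage (by fun_prop)
    obtain ⟨r, hr, hb⟩ := Metric.isOpen_iff.1 hopen (fun l => c l) hc
    exact ⟨r, hr, by rwa [ball_pi _ hr] at hb⟩
  apply Subtype.ext
  refine MvPolynomial.funext_set (fun l => Metric.ball (c l) r) (fun l => ?_) fun x hx => ?_
  · exact (infinite_of_mem_nhds (c l) (Metric.ball_mem_nhds _ hr))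
  · have := hz _ (hball hx)
    simpa [val] using this

/-- There is exactly one `g ∈ V_h` with `∫_Ω g φ = numDerivRHS s l v φ` for all `φ ∈ V_h`. -/
theorem existsUnique_numDeriv (s : ℝ) (l : Fin d) (v : M.DGSpace k) :
    ∃! g : M.DGSpace k, ∀ φ : M.DGSpace k, massForm g φ = numDerivRHS s l v φ := by
  let B : M.DGSpace k →ₗ[ℝ] Module.Dual ℝ (M.DGSpace k) :=
    LinearMap.mk₂ ℝ massForm massForm_add_left massForm_smul_left
      (fun a b c => by
        rw [massForm_comm, massForm_add_left, massForm_comm b, massForm_comm c])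
      (fun c a b => by rw [massForm_comm, massForm_smul_left, massForm_comm b]; rfl)
  have hinj : Function.Injective B := by
    rw [injective_iff_map_eq_zero]
    intro u hu
    exact eq_zero_of_massForm_self u (LinearMap.congr_fun hu u)
  have hsurj : Function.Surjective B :=
    (LinearMap.injective_iff_surjective_of_finrank_eq_finrank
      (Subspace.dual_finrank_eq (K := ℝ) (V := M.DGSpace k)).symm).1 hinj
  let L : Module.Dual ℝ (M.DGSpace k) :=
    { toFun := numDerivRHS s l v
      map_add' := numDerivRHS_add s l v
      map_smul' := fun c φ => numDerivRHS_smul s l v c φ }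
  obtain ⟨g, hg⟩ := hsurj L
  refine ⟨g, fun φ => LinearMap.congr_fun hg φ, fun g' hg' => hinj ?_⟩
  rw [hg]
  exact LinearMap.ext hg'

/-- The one-sided numerical partial derivative `∂_{h,x_l}^±(v) ∈ V_h` (`s = 1` for `+`, `s = -1`
for `-`): `∫_Ω ∂_{h,x_l}^±(v) φ = numDerivRHS s l v φ` for all `φ ∈ V_h`. -/
def sidedDeriv (s : ℝ) (l : Fin d) (v : M.DGSpace k) : M.DGSpace k :=
  (existsUnique_numDeriv s l v).exists.choose

/-- The central numerical partial derivative `∂_{h,x_l}(v) = (∂_{h,x_l}^+(v) + ∂_{h,x_l}^-(v)) / 2`. -/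
def numDeriv (l : Fin d) (v : M.DGSpace k) : M.DGSpace k :=
  (1 / 2 : ℝ) • (sidedDeriv 1 l v + sidedDeriv (-1) l v)

/-- The DG-FE numerical gradient `∇_h v = (∂_{h,x_1}(v), …, ∂_{h,x_d}(v))` on `T_i`. -/
def numGrad (v : M.DGSpace k) (i : Fin M.n) (x : E d) : E d :=
  WithLp.toLp 2 fun l => val (numDeriv l v) i x

/-! ### Norms -/

/-- The norm of a piecewise defined vector field `G` in `L^p(𝒯_h)`:
`(∑_T ∫_T |G|^p dx)^(1/p)`. -/
def lpNorm (p : ℝ) (G : Fin M.n → E d → E d) : ℝ :=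
  (∑ i, ∫ x in M.T i, ‖G i x‖ ^ p) ^ (1 / p)

/-- The weighted jump term `(∑_e ∫_e γ_e h_e^(1-p) |[v]|^p dS)^(1/p)` over the interior edges. -/
def jumpTerm (p : ℝ) (γ : Fin M.n × Fin M.n → ℝ) (v : M.DGSpace k) : ℝ :=
  (∑ e ∈ M.interiorEdges,
    ∫ x in M.edge e, γ e * M.hEdge e ^ (1 - p) * |jump v e x| ^ p ∂(surface d)) ^ (1 / p)

/-- The seminorm of the broken space `W^{1,p}(𝒯_h)`. -/
def brokenSeminorm (p : ℝ) (γ : Fin M.n × Fin M.n → ℝ) (v : M.DGSpace k) : ℝ :=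
  lpNorm p (pwGrad v) + jumpTerm p γ v

end Mesh

end DGCalc

end

open MeasureTheory Set
open scoped RealInnerProductSpace

noncomputable section

namespace DGCalc

/-! The estimate is local: the numerical and the piecewise gradient differ only through jumps.
Averaging the two one-sided derivatives cancels the `sgn` terms and leaves the flux `{v}`.
Integration by parts on each element, where the terms on the boundary of `Ω` cancel, shows that the
defect `w = ∂_{h,l} v - ∂_l v` satisfies `∫_{T_i} w q = -∑_j ∫_{T_i ∩ T_j} (v_i - v_j)/2 ν_l q` for
every polynomial `q` of degree at most `k` (`massForm_numDeriv_sub`, `integral_defect_mul`).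

Taking `q = w` gives `∫_{T_i} w² ≤ J₁ sup |w|` with `J₁` the `L¹` norm of the jumps around `T_i`.
The inverse inequality `h^d sup |w|² ≤ C ∫ w²` then yields `h^d sup |w| ≤ C J₁`
(`exists_abs_defect_le`). Jensen's inequality turns `J₁` into the `L^p` norm of the jumps
(`rpow_jumpL1_div_le`). This needs the interface area of an element to be at most a constant times
`h^(d-1)`, which follows from the divergence theorem for `x - x₀`, with `x₀` the centre of an
inscribed ball (`mul_interfaceArea_le`). No bound on the number of neighbours enters, so hanging
nodes do no harm. Summing over the elements, with `h_e ≤ max(1, τ) h_T`, gives the theorem with `γ*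
= 1`.

The geometric basis is the divergence theorem on a convex polytope (`integral_fderiv_eq_sum_facet`),
proved by casting shadows: a facet integral of `f` is a volume integral of the derivative of `f`
along `v` over the points whose ray in direction `v` meets the facet, and the signed sum of these
shadows is the polytope. The boundary of an element is then split, up to surface measure zero, into
pieces of the boundary of `Ω` and interfaces with other elements (`sum_integral_facet_eq`). -/

/-! ### Fubini along an oblique direction; surface measure on hyperplanes -/

theorem volume_eq_map_hyperplane_prod {V : Type*} [NormedAddCommGroup V] [InnerProductSpace ℝ V]
    [FiniteDimensional ℝ V] [MeasurableSpace V] [BorelSpace V] {a : V} (ha : ‖a‖ = 1) (x₀ v : V)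
    (hv : ⟪a, v⟫ ≠ 0) :
    (volume : Measure V) = ‖⟪a, v⟫‖ₑ •
      ((volume : Measure (ℝ ∙ a)ᗮ).prod (volume : Measure ℝ)).map
        fun q => x₀ + q.1 + q.2 • v := by
  have ha0 : a ≠ 0 := by rintro rfl; simp at ha
  set c := ⟪a, v⟫ with hc
  have hperp : v - c • a ∈ (ℝ ∙ a)ᗮ := by
    rw [Submodule.mem_orthogonal_singleton_iff_inner_right, inner_sub_right, inner_smul_right,
      real_inner_self_eq_norm_sq, ha]
    simp [hc]
  let u : (ℝ ∙ a)ᗮ := ⟨v - c • a, hperp⟩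
  let e : (ℝ ∙ a) := ⟨c • a, Submodule.smul_mem _ _ (Submodule.mem_span_singleton_self a)⟩
  have he : e ≠ 0 := by
    intro h
    have := congrArg Subtype.val h
    simp [e, hv, ha0] at this
  have hline : (volume : Measure (ℝ ∙ a)) = ‖c‖ₑ • (volume : Measure ℝ).map (· • e) := by
    rw [volume_eq_of_finrank_eq_one (finrank_span_singleton ha0) he]
    congr 1
    rw [← ofReal_norm, ← ofReal_norm]
    congr 1
    simp [e, norm_smul, ha]
  -- Writing `v = c a + u` with `u` orthogonal to `a`, oblique coordinates are orthogonal ones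
  -- followed by a shear along `u`, which preserves measure. The factor `|c|` comes only from
  -- scaling the line.
  have hskew : MeasurePreserving
      (fun q : ℝ × (ℝ ∙ a)ᗮ => ((fun t : ℝ => t • e) q.1, (fun t w => w + t • u) q.1 q.2))
      ((volume : Measure ℝ).prod (volume : Measure (ℝ ∙ a)ᗮ))
      (((volume : Measure ℝ).map (· • e)).prod volume) := by
    refine MeasurePreserving.skew_product (g := fun t w => w + t • u) ⟨measurable_id.smul_const e, rfl⟩
      (show Measurable fun q : ℝ × (ℝ ∙ a)ᗮ => q.2 + q.1 • u by fun_prop) ?_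
    exact Filter.Eventually.of_forall fun t => map_add_right_eq_self _ _
  have hE := ((ℝ ∙ a).measurePreserving_measurableEquivProd x₀).symm
  rw [InnerProductSpace.euclideanHausdorffMeasure_eq_volume] at hE
  rw [← hE.map_eq, Measure.volume_eq_prod, hline, Measure.prod_smul_left, Measure.map_smul]
  congr 1
  rw [← hskew.map_eq, ← Measure.prod_swap, Measure.map_map (by fun_prop) (by fun_prop),
    Measure.map_map (by fun_prop) (by fun_prop)]
  congr 1
  funext q
  simp [u, e, smul_sub]
  abel

theorem integral_eq_hyperplane_prod {V : Type*} [NormedAddCommGroup V] [InnerProductSpace ℝ V]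
    [FiniteDimensional ℝ V] [MeasurableSpace V] [BorelSpace V] {a : V} (ha : ‖a‖ = 1) (x₀ v : V)
    (hv : ⟪a, v⟫ ≠ 0) {F : V → ℝ} (hF : Integrable F) :
    ∫ x, F x = |⟪a, v⟫| * ∫ w : (ℝ ∙ a)ᗮ, ∫ t : ℝ, F (x₀ + w + t • v) := by
  have hvol := volume_eq_map_hyperplane_prod ha x₀ v hv
  have hne : ‖⟪a, v⟫‖ₑ ≠ 0 := by simpa using hv
  have hF' : Integrable F (((volume : Measure (ℝ ∙ a)ᗮ).prod (volume : Measure ℝ)).map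
        fun q => x₀ + q.1 + q.2 • v) := by
    rw [hvol] at hF
    exact (integrable_smul_measure hne (by simp)).1 hF
  have hmeas : Measurable fun q : (ℝ ∙ a)ᗮ × ℝ => x₀ + (q.1 : V) + q.2 • v := by fun_prop
  rw [hvol, integral_smul_measure, integral_map hmeas.aemeasurable hF'.aestronglyMeasurable,
    integral_prod (fun q : (ℝ ∙ a)ᗮ × ℝ => F (x₀ + q.1 + q.2 • v))
      ((integrable_map_measure hF'.aestronglyMeasurable hmeas.aemeasurable).1 hF')]
  simp

theorem surface_restrict_hyperplane {d : ℕ} {a : E d} (ha : ‖a‖ = 1) (b : ℝ) :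
    (surface d).restrict {x | ⟪a, x⟫ = b} =
      (volume : Measure (ℝ ∙ a)ᗮ).map fun w : (ℝ ∙ a)ᗮ => b • a + (w : E d) := by
  have ha0 : a ≠ 0 := by rintro rfl; simp at ha
  have hd : d - 1 + 1 = d := by
    rcases d with _ | d
    · exact absurd (Subsingleton.elim a 0) ha0
    · rfl
  have hfin : Module.finrank ℝ (ℝ ∙ a)ᗮ = d - 1 := by
    have : Fact (Module.finrank ℝ (E d) = d - 1 + 1) := ⟨by simp [hd]⟩
    exact Submodule.finrank_orthogonal_span_singleton ha0
  have hf : Isometry fun w : (ℝ ∙ a)ᗮ => b • a + (w : E d) :=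
    (isometry_add_left (b • a)).comp isometry_subtype_coe
  have hr : range (fun w : (ℝ ∙ a)ᗮ => b • a + (w : E d)) = {x | ⟪a, x⟫ = b} := by
    ext x
    simp only [mem_range, mem_ofPred_eq]
    constructor
    · rintro ⟨w, rfl⟩
      rw [inner_add_right, inner_smul_right, real_inner_self_eq_norm_sq, ha,
        Submodule.mem_orthogonal_singleton_iff_inner_right.1 w.2]
      simp
    · intro h
      refine ⟨⟨x - b • a, ?_⟩, by simp⟩
      rw [Submodule.mem_orthogonal_singleton_iff_inner_right, inner_sub_right, inner_smul_right,
        real_inner_self_eq_norm_sq, ha, h]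
      simp
  rw [← hr, surface, ← hf.map_euclideanHausdorffMeasure, ← hfin,
    InnerProductSpace.euclideanHausdorffMeasure_eq_volume]

theorem volume_hyperplane {V : Type*} [NormedAddCommGroup V] [InnerProductSpace ℝ V]
    [FiniteDimensional ℝ V] [MeasurableSpace V] [BorelSpace V] {c : V} (hc : c ≠ 0) (r : ℝ) :
    (volume : Measure V) {x | ⟪c, x⟫ = r} = 0 := by
  let A : AffineSubspace ℝ V := AffineSubspace.mk' ((r / ‖c‖ ^ 2) • c) (ℝ ∙ c)ᗮ
  have hn : ‖c‖ ^ 2 ≠ 0 := by simpa using hc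
  have hA : {x | ⟪c, x⟫ = r} = (A : Set V) := by
    ext x
    simp only [mem_ofPred_eq, SetLike.mem_coe, A, AffineSubspace.mem_mk', vsub_eq_sub,
      Submodule.mem_orthogonal_singleton_iff_inner_right, inner_sub_right, inner_smul_right,
      real_inner_self_eq_norm_sq, div_mul_cancel₀ _ hn, sub_eq_zero]
  rw [hA]
  refine Measure.addHaar_affineSubspace _ _ fun h => ?_
  have h1 : ((r / ‖c‖ ^ 2) • c + c) ∈ A := h ▸ AffineSubspace.mem_top ℝ V _
  have h2 : ((r / ‖c‖ ^ 2) • c + c) ∈ {x | ⟪c, x⟫ = r} := by rw [hA]; exact h1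
  simp only [mem_ofPred_eq, inner_add_right, inner_smul_right, real_inner_self_eq_norm_sq,
    div_mul_cancel₀ _ hn] at h2
  apply hn; linarith

theorem eq_or_eq_neg_of_smul_eq {V : Type*} [NormedAddCommGroup V] [InnerProductSpace ℝ V]
    {a a' : V} (ha : ‖a‖ = 1) (ha' : ‖a'‖ = 1) {s s' : ℝ} (hs : s ≠ 0) (h : s • a = s' • a') :
    a' = a ∨ a' = -a := by
  have hn : |s| = |s'| := by simpa [norm_smul, ha, ha'] using congrArg norm h
  rcases abs_eq_abs.1 hn with rfl | rfl
  · left; exact (smul_right_injective V hs h).symm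
  · right
    have : s' ≠ 0 := by simpa using hs
    apply smul_right_injective V this
    simp only [← h]; simp

/-- The component of `a'` orthogonal to `a` is nonzero, so the second hyperplane cuts the first in a
proper affine hyperplane of it. -/
theorem surface_inter_hyperplanes {d : ℕ} {a a' : E d} (ha : ‖a‖ = 1) (ha' : ‖a'‖ = 1)
    (h1 : a' ≠ a) (h2 : a' ≠ -a) (b b' : ℝ) :
    surface d {x | ⟪a, x⟫ = b ∧ ⟪a', x⟫ = b'} = 0 := by
  have hm : MeasurableSet {x : E d | ⟪a', x⟫ = b'} :=
    (isClosed_eq (by fun_prop) continuous_const).measurableSet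
  have hset : {x : E d | ⟪a, x⟫ = b ∧ ⟪a', x⟫ = b'} = {x | ⟪a', x⟫ = b'} ∩ {x | ⟪a, x⟫ = b} := by
    ext x; simp [and_comm]
  rw [hset, ← Measure.restrict_apply hm, surface_restrict_hyperplane ha,
    Measure.map_apply (by fun_prop) hm]
  have hperp : a' - ⟪a, a'⟫ • a ∈ (ℝ ∙ a)ᗮ := by
    rw [Submodule.mem_orthogonal_singleton_iff_inner_right, inner_sub_right, inner_smul_right,
      real_inner_self_eq_norm_sq, ha]
    simp
  have hc : (⟨a' - ⟪a, a'⟫ • a, hperp⟩ : (ℝ ∙ a)ᗮ) ≠ 0 := by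
    intro h
    have h3 : (1 : ℝ) • a' = ⟪a, a'⟫ • a := by
      rw [one_smul]; exact sub_eq_zero.1 (congrArg Subtype.val h)
    rcases eq_or_eq_neg_of_smul_eq ha' ha one_ne_zero h3 with h | h
    · exact h1 h.symm
    · exact h2 (by rw [h, neg_neg])
  refine measure_mono_null (fun w hw => ?_) (volume_hyperplane hc (b' - b * ⟪a, a'⟫))
  simp only [mem_preimage, mem_ofPred_eq, inner_add_right, inner_smul_right] at hw
  simp only [mem_ofPred_eq, Submodule.coe_inner, inner_sub_left, inner_smul_left,
    Submodule.mem_orthogonal_singleton_iff_inner_right.1 w.2]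
  rw [real_inner_comm] at hw
  rw [mul_zero, sub_zero]
  linarith

/-! ### The divergence theorem on a convex polytope -/

namespace ConvexPolytope
variable {d : ℕ}

/-- The time at which the line `t ↦ x + t v` meets the hyperplane `⟪a, ·⟫ = b`, `H = (a, b)`. -/
def hitTime (H : E d × ℝ) (v x : E d) : ℝ := (H.2 - ⟪H.1, x⟫) / ⟪H.1, v⟫

/-- The points from which the ray in direction `v` meets the facet of `T` on the hyperplane `H`. -/
def shadow (T : ConvexPolytope d) (H : E d × ℝ) (v : E d) : Set (E d) :=
  {x | 0 ≤ hitTime H v x ∧ x + hitTime H v x • v ∈ T.carrier}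

theorem continuous_hitTime (H : E d × ℝ) (v : E d) : Continuous (hitTime H v) := by
  unfold hitTime
  fun_prop

theorem measurableSet_shadow (T : ConvexPolytope d) (H : E d × ℝ) (v : E d) :
    MeasurableSet (T.shadow H v) := by
  have hc := continuous_hitTime H v
  exact ((isClosed_le continuous_const hc).inter (T.isCompact_carrier.isClosed.preimage
    (by fun_prop : Continuous fun x => x + hitTime H v x • v))).measurableSet

/-- On the line `y + t v` through a point `y` of the facet, the shadow is the half-line `t ≤ 0`,
over which the derivative of the compactly supported `f` integrates to `f y`. Fubini in these
coordinates has Jacobian `|⟪H.1, v⟫|`, and the sign restores `⟪H.1, v⟫`. -/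
theorem inner_mul_integral_facet (T : ConvexPolytope d) {H : E d × ℝ} (hH : ‖H.1‖ = 1) {v : E d}
    (hv : ⟪H.1, v⟫ ≠ 0) {f : E d → ℝ} (hf : ContDiff ℝ 1 f) (hfs : HasCompactSupport f) :
    ⟪H.1, v⟫ * ∫ x in T.facet H, f x ∂(surface d) =
      Real.sign ⟪H.1, v⟫ * ∫ x in T.shadow H v, fderiv ℝ f x v := by
  have hv0 : v ≠ 0 := by rintro rfl; simp at hv
  have hmT : MeasurableSet T.carrier := T.isCompact_carrier.isClosed.measurableSet
  have hmg : Measurable fun w : (ℝ ∙ H.1)ᗮ => H.2 • H.1 + (w : E d) := by fun_prop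
  have hfd : Integrable fun x => fderiv ℝ f x v :=
    Continuous.integrable_of_hasCompactSupport
      ((hf.continuous_fderiv one_ne_zero).clm_apply continuous_const) (hfs.fderiv_apply ℝ v)
  have hleft : ∫ x in T.facet H, f x ∂(surface d) =
      ∫ w : (ℝ ∙ H.1)ᗮ, T.carrier.indicator f (H.2 • H.1 + (w : E d)) := by
    have : T.facet H = T.carrier ∩ {x | ⟪H.1, x⟫ = H.2} := rfl
    rw [this, ← Measure.restrict_restrict hmT, surface_restrict_hyperplane hH,
      setIntegral_map hmT hf.continuous.aestronglyMeasurable hmg.aemeasurable,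
      ← integral_indicator (hmg hmT)]
    rfl
  have hright : ∫ x in T.shadow H v, fderiv ℝ f x v =
      |⟪H.1, v⟫| * ∫ w : (ℝ ∙ H.1)ᗮ, T.carrier.indicator f (H.2 • H.1 + (w : E d)) := by
    rw [← integral_indicator (T.measurableSet_shadow H v),
      integral_eq_hyperplane_prod hH (H.2 • H.1) v hv
        (hfd.indicator (T.measurableSet_shadow H v))]
    congr 2
    funext w
    set y := H.2 • H.1 + (w : E d) with hy
    have hyH : ⟪H.1, y⟫ = H.2 := by
      rw [hy, inner_add_right, inner_smul_right, real_inner_self_eq_norm_sq, hH,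
        Submodule.mem_orthogonal_singleton_iff_inner_right.1 w.2]
      simp
    have ht : ∀ t : ℝ, hitTime H v (y + t • v) = -t := by
      intro t
      rw [hitTime, inner_add_right, inner_smul_right, hyH]
      field_simp
      ring
    have hmem : ∀ t : ℝ, y + t • v ∈ T.shadow H v ↔ t ≤ 0 ∧ y ∈ T.carrier := by
      intro t
      simp [shadow, ht]
    by_cases hyT : y ∈ T.carrier
    · rw [indicator_of_mem hyT]
      let g : ℝ → ℝ := fun t => f (y + t • v)
      have hg : ContDiff ℝ 1 g := hf.comp (by fun_prop)
      have hgs : HasCompactSupport g := by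
        refine hfs.comp_isClosedEmbedding ?_
        exact (Homeomorph.addLeft y).isClosedEmbedding.comp (isClosedEmbedding_smul_left hv0)
      have hgd : ∀ t, deriv g t = fderiv ℝ f (y + t • v) v := by
        intro t
        have h1 : HasDerivAt (fun t : ℝ => y + t • v) v t := by
          simpa using ((hasDerivAt_id t).smul_const v).const_add y
        exact ((hf.differentiable one_ne_zero _).hasFDerivAt.comp_hasDerivAt t h1).deriv
      have h0 := hgs.integral_Iic_deriv_eq hg 0
      rw [← integral_indicator measurableSet_Iic] at h0
      simp only [g, zero_smul, add_zero] at h0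
      rw [← h0]
      congr 1
      funext t
      by_cases h : t ≤ 0
      · rw [indicator_of_mem ((hmem t).2 ⟨h, hyT⟩), indicator_of_mem (mem_Iic.2 h)]
        exact (hgd t).symm
      · rw [indicator_of_notMem (fun h' => h ((hmem t).1 h').1),
          indicator_of_notMem (show t ∉ Iic 0 from h)]
    · rw [indicator_of_notMem hyT]
      refine integral_eq_zero_of_ae (Filter.Eventually.of_forall fun t => ?_)
      exact indicator_of_notMem (fun h' => hyT ((hmem t).1 h').2) _
  rw [hleft, hright, ← mul_assoc]
  congr 1
  rcases lt_or_gt_of_ne hv with h | h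
  · rw [Real.sign_of_neg h, abs_of_neg h]; ring
  · rw [Real.sign_of_pos h, abs_of_pos h]; ring

/-- Restricted to a line, each half-space bounds `t` above, bounds it below, or does not involve
`t`, according to the sign of `⟪H.1, v⟫`. -/
theorem add_smul_mem_carrier_iff (T : ConvexPolytope d) (v x : E d) (t : ℝ) :
    x + t • v ∈ T.carrier ↔ ∀ H ∈ T.halfSpaces, (0 < ⟪H.1, v⟫ → t ≤ hitTime H v x) ∧
      (⟪H.1, v⟫ < 0 → hitTime H v x ≤ t) ∧ (⟪H.1, v⟫ = 0 → ⟪H.1, x⟫ ≤ H.2) := by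
  refine forall₂_congr fun H _ => ?_
  rw [inner_add_right, inner_smul_right, hitTime]
  rcases lt_trichotomy ⟪H.1, v⟫ 0 with h | h | h
  · simp only [h, h.ne, not_lt.2 h.le, div_le_iff_of_neg h, false_imp_iff, true_and, and_true,
      true_imp_iff]
    constructor <;> intro <;> linarith
  · simp [h]
  · simp only [h, h.ne', not_lt.2 h.le, le_div_iff₀ h, false_imp_iff, and_true, true_imp_iff]
    constructor <;> intro <;> linarith

theorem exists_inner_pos (T : ConvexPolytope d) {v x : E d} (hv : v ≠ 0) {s : ℝ}
    (hs : x + s • v ∈ T.carrier) : ∃ H ∈ T.halfSpaces, 0 < ⟪H.1, v⟫ := by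
  by_contra! hcon
  have hall : ∀ t : ℝ, s ≤ t → x + t • v ∈ T.carrier := by
    intro t ht
    rw [add_smul_mem_carrier_iff] at hs ⊢
    intro H hH
    obtain ⟨-, h2, h3⟩ := hs H hH
    exact ⟨fun h => absurd h (not_lt.2 (hcon H hH)), fun h => (h2 h).trans ht, h3⟩
  obtain ⟨R, hR⟩ := T.isBounded.subset_closedBall 0
  have hvn : 0 < ‖v‖ := norm_pos_iff.2 hv
  set t := max s ((R + ‖x‖ + 1) / ‖v‖) with ht
  have h1 : ‖x + t • v‖ ≤ R := by
    simpa using hR (hall t (le_max_left _ _))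
  have h2 : R + ‖x‖ + 1 ≤ t * ‖v‖ := (div_le_iff₀ hvn).1 (le_max_right _ _)
  have h3 : ‖t • v‖ ≤ ‖x + t • v‖ + ‖x‖ := by
    simpa using norm_sub_le (x + t • v) x
  have h4 : t * ‖v‖ ≤ ‖t • v‖ := by
    rw [norm_smul]
    exact mul_le_mul_of_nonneg_right (le_abs_self t) hvn.le
  linarith

open Classical in
-- A ray that meets `T` leaves it through exactly one facet, counted `+1`, and enters it through
-- exactly one facet, counted `-1`, when it starts outside; from inside there is no entry. The
-- hypotheses exclude starting points on a facet plane and rays through two facet planes at once.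
theorem sum_sign_shadow (T : ConvexPolytope d) {v x : E d} (hv : v ≠ 0)
    (h0 : ∀ H ∈ T.halfSpaces, ⟪H.1, v⟫ ≠ 0 → hitTime H v x ≠ 0)
    (h1 : ∀ H ∈ T.halfSpaces, ∀ H' ∈ T.halfSpaces, ⟪H.1, v⟫ ≠ 0 → ⟪H'.1, v⟫ ≠ 0 →
      hitTime H v x = hitTime H' v x → H = H') :
    ∑ H ∈ T.halfSpaces, Real.sign ⟪H.1, v⟫ * (if x ∈ T.shadow H v then 1 else 0) =
      if x ∈ T.carrier then 1 else 0 := by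
  set O := T.halfSpaces.filter fun H => 0 < ⟪H.1, v⟫ with hO
  set I := T.halfSpaces.filter fun H => ⟪H.1, v⟫ < 0 with hI
  have hsplit : ∑ H ∈ T.halfSpaces, Real.sign ⟪H.1, v⟫ * (if x ∈ T.shadow H v then (1 : ℝ) else 0)
      = (∑ H ∈ O, if x ∈ T.shadow H v then (1 : ℝ) else 0)
        - ∑ H ∈ I, if x ∈ T.shadow H v then (1 : ℝ) else 0 := by
    rw [hO, hI, Finset.sum_filter, Finset.sum_filter, ← Finset.sum_sub_distrib]
    refine Finset.sum_congr rfl fun H _ => ?_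
    rcases lt_trichotomy ⟪H.1, v⟫ 0 with h | h | h
    · split_ifs <;> simp_all [Real.sign_of_neg h, not_lt.2 h.le]
    · simp [h]
    · simp [Real.sign_of_pos h, h, not_lt.2 h.le]
  rw [hsplit]
  by_cases hne : ∃ s : ℝ, 0 ≤ s ∧ x + s • v ∈ T.carrier
  swap
  · have hsh : ∀ H, x ∉ T.shadow H v := fun H h => hne ⟨_, h⟩
    have hx : x ∉ T.carrier := fun h => hne ⟨0, le_rfl, by simpa using h⟩
    simp [hsh, hx]
  obtain ⟨s, hs0, hs⟩ := hne
  have hs' := (T.add_smul_mem_carrier_iff v x s).1 hs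
  -- The exit facet is the outgoing half-space with the smallest hit time; it exists because `T` is
  -- bounded.
  have hout : (∑ H ∈ O, if x ∈ T.shadow H v then (1 : ℝ) else 0) = 1 := by
    obtain ⟨H₁, hH₁, hpos⟩ := T.exists_inner_pos hv hs
    obtain ⟨H₀, hH₀, hmin⟩ := O.exists_min_image (fun H => hitTime H v x)
      ⟨H₁, Finset.mem_filter.2 ⟨hH₁, hpos⟩⟩
    have hH₀' := Finset.mem_filter.1 hH₀
    have hst : s ≤ hitTime H₀ v x := (hs' H₀ hH₀'.1).1 hH₀'.2
    rw [Finset.sum_eq_single_of_mem H₀ hH₀, if_pos]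
    · refine ⟨hs0.trans hst, (T.add_smul_mem_carrier_iff v x _).2 fun H hH =>
        ⟨fun h => ?_, fun h => ?_, ?_⟩⟩
      · exact hmin H (Finset.mem_filter.2 ⟨hH, h⟩)
      · exact ((hs' H hH).2.1 h).trans hst
      · exact (hs' H hH).2.2
    · intro H hH hHne
      have hH' := Finset.mem_filter.1 hH
      refine if_neg fun hsh => hHne ?_
      refine h1 H hH'.1 H₀ hH₀'.1 hH'.2.ne' hH₀'.2.ne' (le_antisymm ?_ (hmin H hH))
      exact ((T.add_smul_mem_carrier_iff v x _).1 hsh.2 H₀ hH₀'.1).1 hH₀'.2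
  rw [hout]
  by_cases hx : x ∈ T.carrier
  · have hin : (∑ H ∈ I, if x ∈ T.shadow H v then (1 : ℝ) else 0) = 0 := by
      refine Finset.sum_eq_zero fun H hH => if_neg fun hsh => ?_
      have hH' := Finset.mem_filter.1 hH
      have hx' : x + (0 : ℝ) • v ∈ T.carrier := by simpa using hx
      have := ((T.add_smul_mem_carrier_iff v x 0).1 hx' H hH'.1).2.1 hH'.2
      exact h0 H hH'.1 hH'.2.ne (le_antisymm this hsh.1)
    rw [hin, if_pos hx, sub_zero]
  · rw [if_neg hx]
    have hx' : x + (0 : ℝ) • v ∉ T.carrier := by simpa using hx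
    rw [add_smul_mem_carrier_iff] at hx'
    push Not at hx'
    obtain ⟨H₁, hH₁, hbad⟩ := hx'
    have hneg : ⟪H₁.1, v⟫ < 0 ∧ 0 < hitTime H₁ v x := by
      by_contra hcon
      have hA : 0 < ⟪H₁.1, v⟫ → 0 ≤ hitTime H₁ v x := fun h => hs0.trans ((hs' H₁ hH₁).1 h)
      have hB : ⟪H₁.1, v⟫ < 0 → hitTime H₁ v x ≤ 0 := fun h => not_lt.1 fun h' => hcon ⟨h, h'⟩
      obtain ⟨hC, hD⟩ := hbad hA hB
      exact absurd ((hs' H₁ hH₁).2.2 hC) (not_le.2 hD)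
    obtain ⟨H₀, hH₀, hmax⟩ := I.exists_max_image (fun H => hitTime H v x)
      ⟨H₁, Finset.mem_filter.2 ⟨hH₁, hneg.1⟩⟩
    have hH₀' := Finset.mem_filter.1 hH₀
    have hst : hitTime H₀ v x ≤ s := (hs' H₀ hH₀'.1).2.1 hH₀'.2
    -- Dually, the entry facet is the incoming half-space with the largest hit time.
    have hin : (∑ H ∈ I, if x ∈ T.shadow H v then (1 : ℝ) else 0) = 1 := by
      rw [Finset.sum_eq_single_of_mem H₀ hH₀, if_pos]
      · refine ⟨hneg.2.le.trans (hmax H₁ (Finset.mem_filter.2 ⟨hH₁, hneg.1⟩)),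
          (T.add_smul_mem_carrier_iff v x _).2 fun H hH => ⟨fun h => ?_, fun h => ?_, ?_⟩⟩
        · exact hst.trans ((hs' H hH).1 h)
        · exact hmax H (Finset.mem_filter.2 ⟨hH, h⟩)
        · exact (hs' H hH).2.2
      · intro H hH hHne
        have hH' := Finset.mem_filter.1 hH
        refine if_neg fun hsh => hHne ?_
        refine h1 H hH'.1 H₀ hH₀'.1 hH'.2.ne hH₀'.2.ne (le_antisymm (hmax H hH) ?_)
        exact ((T.add_smul_mem_carrier_iff v x _).1 hsh.2 H₀ hH₀'.1).2.1 hH₀'.2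
    rw [hin, sub_self]

/-- Two opposite half-spaces with the same bounding plane would squeeze `T` into that plane, which
has volume zero. -/
theorem not_flat (T : ConvexPolytope d) (hT : (interior T.carrier).Nonempty) {a : E d} {b : ℝ}
    (h : (a, b) ∈ T.halfSpaces) (h' : (-a, -b) ∈ T.halfSpaces) : False := by
  have ha : a ≠ 0 := by
    intro h0
    have := T.norm_eq_one _ h
    simp [h0] at this
  have hsub : T.carrier ⊆ {x | ⟪a, x⟫ = b} := by
    intro x hx
    have h1 := hx _ h
    have h2 := hx _ h'
    simp only [inner_neg_left] at h1 h2
    exact le_antisymm h1 (by linarith)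
  have hpos : 0 < volume (interior T.carrier) := isOpen_interior.measure_pos _ hT
  exact hpos.ne' (measure_mono_null (interior_subset.trans hsub) (volume_hyperplane ha b))

theorem ae_hitTime_ne_zero {H : E d × ℝ} (hH : ‖H.1‖ = 1) {v : E d} (hv : ⟪H.1, v⟫ ≠ 0) :
    ∀ᵐ x : E d, hitTime H v x ≠ 0 := by
  have ha : H.1 ≠ 0 := by intro h; simp [h] at hH
  rw [ae_iff]
  refine measure_mono_null (fun x hx => ?_) (volume_hyperplane ha H.2)
  have : hitTime H v x = 0 := not_not.1 hx
  rw [hitTime, div_eq_zero_iff, or_iff_left hv, sub_eq_zero] at this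
  exact this.symm

/-- Equality of the two hit times is a linear equation in `x`. Either its normal is nonzero and the
solutions form a null set, or the two unit normals are parallel; then equal normals force `H = H'`
and opposite ones are excluded by `not_flat`. -/
theorem ae_hitTime_injective (T : ConvexPolytope d) (hT : (interior T.carrier).Nonempty)
    {H H' : E d × ℝ} (hH : H ∈ T.halfSpaces) (hH' : H' ∈ T.halfSpaces) {v : E d}
    (hv : ⟪H.1, v⟫ ≠ 0) (hv' : ⟪H'.1, v⟫ ≠ 0) :
    ∀ᵐ x : E d, hitTime H v x = hitTime H' v x → H = H' := by
  by_cases hc : ⟪H.1, v⟫ • H'.1 - ⟪H'.1, v⟫ • H.1 = 0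
  · refine Filter.Eventually.of_forall fun x hx => ?_
    rw [hitTime, hitTime, div_eq_div_iff hv hv'] at hx
    rcases eq_or_eq_neg_of_smul_eq (T.norm_eq_one _ hH') (T.norm_eq_one _ hH) hv
      (sub_eq_zero.1 hc) with h | h
    · rw [h] at hx
      exact Prod.ext h (by have := mul_right_cancel₀ hv' hx; linarith)
    · exfalso
      have h2 : H.2 = -H'.2 := by
        rw [h, inner_neg_left, inner_neg_left] at hx
        have : (H.2 + H'.2) * ⟪H'.1, v⟫ = 0 := by linarith
        rcases mul_eq_zero.1 this with h3 | h3
        · linarith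
        · exact absurd h3 hv'
      exact T.not_flat hT (a := H'.1) (b := H'.2) hH' (by rw [← h, ← h2]; exact hH)
  · rw [ae_iff]
    refine measure_mono_null (fun x hx => ?_)
      (volume_hyperplane hc (⟪H.1, v⟫ * H'.2 - ⟪H'.1, v⟫ * H.2))
    have hx' : hitTime H v x = hitTime H' v x := by
      by_contra hne
      exact hx fun h => absurd h hne
    rw [hitTime, hitTime, div_eq_div_iff hv hv'] at hx'
    simp only [mem_ofPred_eq, inner_sub_left, real_inner_smul_left]
    linarith

theorem integral_fderiv_eq_sum_facet_of_hasCompactSupport (T : ConvexPolytope d)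
    (hT : (interior T.carrier).Nonempty) {f : E d → ℝ} (hf : ContDiff ℝ 1 f)
    (hfs : HasCompactSupport f) (v : E d) :
    ∫ x in T.carrier, fderiv ℝ f x v =
      ∑ H ∈ T.halfSpaces, ⟪H.1, v⟫ * ∫ x in T.facet H, f x ∂(surface d) := by
  classical
  rcases eq_or_ne v 0 with rfl | hv
  · simp
  have hfd : Integrable fun x => fderiv ℝ f x v :=
    Continuous.integrable_of_hasCompactSupport
      ((hf.continuous_fderiv one_ne_zero).clm_apply continuous_const) (hfs.fderiv_apply ℝ v)
  have hfacet : ∀ H ∈ T.halfSpaces, ⟪H.1, v⟫ * ∫ x in T.facet H, f x ∂(surface d) =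
      ∫ x, Real.sign ⟪H.1, v⟫ * (T.shadow H v).indicator (fun x => fderiv ℝ f x v) x := by
    intro H hH
    rcases eq_or_ne ⟪H.1, v⟫ 0 with h | h
    · simp [h]
    · rw [T.inner_mul_integral_facet (T.norm_eq_one H hH) h hf hfs, integral_const_mul,
        integral_indicator (T.measurableSet_shadow H v)]
  rw [Finset.sum_congr rfl hfacet, ← integral_finsetSum,
    ← integral_indicator T.isCompact_carrier.isClosed.measurableSet]
  swap
  · exact fun H _ => (hfd.indicator (T.measurableSet_shadow H v)).const_mul _
  refine integral_congr_ae ?_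
  have hg0 : ∀ᵐ x : E d, ∀ H ∈ T.halfSpaces, ⟪H.1, v⟫ ≠ 0 → hitTime H v x ≠ 0 := by
    rw [Filter.eventually_all_finset]
    intro H hH
    by_cases h : ⟪H.1, v⟫ = 0
    · exact Filter.Eventually.of_forall fun _ h' => absurd h h'
    · filter_upwards [ae_hitTime_ne_zero (T.norm_eq_one H hH) h] with x hx _ using hx
  have hg1 : ∀ᵐ x : E d, ∀ H ∈ T.halfSpaces, ∀ H' ∈ T.halfSpaces, ⟪H.1, v⟫ ≠ 0 →
      ⟪H'.1, v⟫ ≠ 0 → hitTime H v x = hitTime H' v x → H = H' := by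
    rw [Filter.eventually_all_finset]
    intro H hH
    rw [Filter.eventually_all_finset]
    intro H' hH'
    by_cases h : ⟪H.1, v⟫ = 0
    · exact Filter.Eventually.of_forall fun _ h' => absurd h h'
    by_cases h'' : ⟪H'.1, v⟫ = 0
    · exact Filter.Eventually.of_forall fun _ _ h' => absurd h'' h'
    filter_upwards [T.ae_hitTime_injective hT hH hH' h h''] with x hx _ _ using hx
  filter_upwards [hg0, hg1] with x h0 h1
  have hsum := T.sum_sign_shadow hv h0 h1
  have hind : ∀ S : Set (E d), S.indicator (fun x => fderiv ℝ f x v) x =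
      (if x ∈ S then 1 else 0) * fderiv ℝ f x v := by
    intro S
    by_cases h : x ∈ S <;> simp [h]
  simp only [hind, ← mul_assoc]
  rw [← Finset.sum_mul, hsum]

/-- The divergence theorem on a convex polytope, for the field `f v` with `v` constant. -/
theorem integral_fderiv_eq_sum_facet (T : ConvexPolytope d)
    (hT : (interior T.carrier).Nonempty) {f : E d → ℝ} (hf : ContDiff ℝ 1 f) (v : E d) :
    ∫ x in T.carrier, fderiv ℝ f x v =
      ∑ H ∈ T.halfSpaces, ⟪H.1, v⟫ * ∫ x in T.facet H, f x ∂(surface d) := by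
  obtain ⟨R, hR0, hR⟩ := T.isBounded.subset_ball_lt 0 0
  -- The cutoff equals `1` near every point of `T`, so neither side of the identity sees it.
  let χ : ContDiffBump (0 : E d) := ⟨R, R + 1, hR0, by linarith⟩
  have hχ : ∀ x ∈ T.carrier, (fun y => χ y * f y) =ᶠ[nhds x] f := by
    intro x hx
    filter_upwards [χ.eventuallyEq_one_of_mem_ball (hR hx)] with y hy
    simp [hy]
  have h := T.integral_fderiv_eq_sum_facet_of_hasCompactSupport hT
    (f := fun y => χ y * f y) (χ.contDiff.mul hf) χ.hasCompactSupport.mul_right v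
  rw [setIntegral_congr_fun T.isCompact_carrier.isClosed.measurableSet
    (g := fun x => fderiv ℝ f x v) (fun x hx => by simp only [(hχ x hx).fderiv_eq])] at h
  rw [h]
  refine Finset.sum_congr rfl fun H _ => ?_
  rw [setIntegral_congr_fun (T.isCompact_facet H).isClosed.measurableSet
    (g := f) fun x hx => (hχ x hx.1).eq_of_nhds]

end ConvexPolytope

/-! ### Local shape of a polytope near a point of a facet -/

open Filter Topology

theorem eventually_nhdsGT_add_smul {V : Type*} [NormedAddCommGroup V] [NormedSpace ℝ V]
    {P : V → Prop} {x : V} (u : V) (h : ∀ᶠ y in 𝓝 x, P y) :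
    ∀ᶠ ε : ℝ in 𝓝[>] 0, P (x + ε • u) := by
  have ht : Tendsto (fun ε : ℝ => x + ε • u) (𝓝[>] 0) (𝓝 x) := by
    have : Tendsto (fun ε : ℝ => x + ε • u) (𝓝 0) (𝓝 (x + (0 : ℝ) • u)) :=
      Continuous.tendsto (by fun_prop) 0
    rw [zero_smul, add_zero] at this
    exact this.mono_left nhdsWithin_le_nhds
  exact ht.eventually h

namespace ConvexPolytope
variable {d : ℕ}

/-- Near `x` the polytope `T` is the half-space `⟪a, y⟫ ≤ ⟪a, x⟫`. -/
def IsNormalAt (T : ConvexPolytope d) (x a : E d) : Prop :=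
  ‖a‖ = 1 ∧ ∀ᶠ y in 𝓝 x, (y ∈ T.carrier ↔ ⟪a, y⟫ ≤ ⟪a, x⟫)

theorem eventually_nonactive (T : ConvexPolytope d) {x : E d} (hx : x ∈ T.carrier) :
    ∀ᶠ y in 𝓝 x, ∀ H ∈ T.halfSpaces, ⟪H.1, x⟫ ≠ H.2 → ⟪H.1, y⟫ ≤ H.2 := by
  rw [eventually_all_finset]
  intro H hH
  by_cases h : ⟪H.1, x⟫ = H.2
  · exact Eventually.of_forall fun _ h' => absurd h h'
  · have hlt : ⟪H.1, x⟫ < H.2 := lt_of_le_of_ne (hx H hH) h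
    have hc : Continuous fun y : E d => ⟪H.1, y⟫ := by fun_prop
    filter_upwards [hc.continuousAt.eventually_lt continuousAt_const hlt] with y hy _ using hy.le

theorem exists_active_of_notMem_interior (T : ConvexPolytope d) {x : E d} (hx : x ∈ T.carrier)
    (hxi : x ∉ interior T.carrier) : ∃ H ∈ T.halfSpaces, ⟪H.1, x⟫ = H.2 := by
  by_contra! hcon
  refine hxi (mem_interior_iff_mem_nhds.2 ?_)
  filter_upwards [T.eventually_nonactive hx] with y hy H hH using hy H hH (hcon H hH)

theorem eq_of_active (T : ConvexPolytope d) (hT : (interior T.carrier).Nonempty) {x : E d}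
    {H H' : E d × ℝ} (hH : H ∈ T.halfSpaces) (hH' : H' ∈ T.halfSpaces) (hx : ⟪H.1, x⟫ = H.2)
    (hx' : ⟪H'.1, x⟫ = H'.2) (h : H'.1 = H.1 ∨ H'.1 = -H.1) : H' = H := by
  rcases h with h | h
  · exact Prod.ext h (by rw [← hx, ← hx', h])
  · exfalso
    have h2 : H'.2 = -H.2 := by rw [← hx, ← hx', h, inner_neg_left]
    exact T.not_flat hT (a := H.1) (b := H.2) hH (by rw [← h, ← h2]; exact hH')

theorem isNormalAt_of_active (T : ConvexPolytope d)
    {x : E d} (hx : x ∈ T.carrier) {H : E d × ℝ} (hH : H ∈ T.halfSpaces) (hxH : ⟪H.1, x⟫ = H.2)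
    (huniq : ∀ H' ∈ T.halfSpaces, ⟪H'.1, x⟫ = H'.2 → H' = H) : T.IsNormalAt x H.1 := by
  refine ⟨T.norm_eq_one H hH, ?_⟩
  filter_upwards [T.eventually_nonactive hx] with y hy
  rw [hxH]
  refine ⟨fun h => h H hH, fun h H' hH' => ?_⟩
  by_cases hact : ⟪H'.1, x⟫ = H'.2
  · rw [huniq H' hH' hact]; exact h
  · exact hy H' hH' hact

theorem IsNormalAt.notMem_interior {T : ConvexPolytope d} {x a : E d} (h : T.IsNormalAt x a) :
    x ∉ interior T.carrier := by
  intro hx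
  have h1 := eventually_nhdsGT_add_smul a (h.2.and (mem_interior_iff_mem_nhds.1 hx))
  obtain ⟨ε, ⟨hε1, hε2⟩, hε⟩ := (h1.and self_mem_nhdsWithin).exists
  have := hε1.1 hε2
  rw [inner_add_right, inner_smul_right, real_inner_self_eq_norm_sq, h.1] at this
  have : (0 : ℝ) < ε := hε
  linarith

/-- Both polytopes contain a neighbourhood of `x - ε a` for small `ε > 0`. -/
theorem IsNormalAt.not_disjoint {T T' : ConvexPolytope d} {x a : E d} (h : T.IsNormalAt x a)
    (h' : T'.IsNormalAt x a) : ¬ Disjoint (interior T.carrier) (interior T'.carrier) := by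
  have h1 := eventually_nhdsGT_add_smul (-a) (h.2.and h'.2).eventually_nhds
  obtain ⟨ε, hε1, hε⟩ := (h1.and self_mem_nhdsWithin).exists
  have hε' : (0 : ℝ) < ε := hε
  have hlt : ⟪a, x + ε • -a⟫ < ⟪a, x⟫ := by
    rw [inner_add_right, inner_smul_right, inner_neg_right, real_inner_self_eq_norm_sq, h.1]
    linarith
  have hc : Continuous fun y : E d => ⟪a, y⟫ := by fun_prop
  have h2 := hc.continuousAt.eventually_lt continuousAt_const hlt
  refine not_disjoint_iff.2 ⟨x + ε • -a, ?_, ?_⟩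
  · refine mem_interior_iff_mem_nhds.2 ?_
    filter_upwards [hε1, h2] with y hy hy2 using hy.1.2 hy2.le
  · refine mem_interior_iff_mem_nhds.2 ?_
    filter_upwards [hε1, h2] with y hy hy2 using hy.2.2 hy2.le

/-- Any separating normal is recovered from the local half-space: testing with the tangential part
of `ν` gives `1 ≤ ⟪ν, a⟫²`, testing with `-a` gives `0 ≤ ⟪ν, a⟫`, and equality in Cauchy-Schwarz
follows. This identifies the normal chosen in `edgeNormal` with the facet normal. -/
theorem IsNormalAt.eq_of_separates {T : ConvexPolytope d} {x a ν : E d} (h : T.IsNormalAt x a)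
    (hν : ‖ν‖ = 1) (hsep : ∀ y ∈ T.carrier, ⟪ν, y⟫ ≤ ⟪ν, x⟫) : ν = a := by
  have hdir : ∀ u : E d, ⟪a, u⟫ ≤ 0 → ⟪ν, u⟫ ≤ 0 := by
    intro u hu
    obtain ⟨ε, hε1, hε⟩ := ((eventually_nhdsGT_add_smul u h.2).and self_mem_nhdsWithin).exists
    have hε' : (0 : ℝ) < ε := hε
    have h1 := hsep _ (hε1.2 (by
      rw [inner_add_right, inner_smul_right]
      nlinarith))
    rw [inner_add_right, inner_smul_right] at h1
    by_contra! hcon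
    have := mul_pos hε' hcon
    linarith
  have h1 := hdir (ν - ⟪a, ν⟫ • a) (by
    rw [inner_sub_right, inner_smul_right, real_inner_self_eq_norm_sq, h.1]; simp)
  have h2 := hdir (-a) (by rw [inner_neg_right, real_inner_self_eq_norm_sq, h.1]; simp)
  rw [inner_sub_right, inner_smul_right, real_inner_self_eq_norm_sq, hν, real_inner_comm] at h1
  rw [inner_neg_right] at h2
  have h3 := real_inner_le_norm ν a
  rw [hν, h.1] at h3
  have h4 : ⟪ν, a⟫ = 1 := le_antisymm (by linarith) (by nlinarith)
  exact (inner_eq_one_iff_of_norm_eq_one hν h.1).1 h4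

end ConvexPolytope

/-! ### Splitting the boundary of an element into boundary edges and interfaces -/

namespace Mesh
variable {d : ℕ} {Ω : Set (E d)} (M : Mesh Ω)

/-- The unit normal pointing out of `T_i` into `T_j`. -/
def outNormal (i j : Fin M.n) : E d :=
  if i < j then M.edgeNormal (i, j) else -M.edgeNormal (j, i)

theorem edgeNormal_spec (e : Fin M.n × Fin M.n) (h : e.1 ≠ e.2) :
    ‖M.edgeNormal e‖ = 1 ∧ ∀ x ∈ M.T e.1, ∀ y ∈ M.T e.2,
      ⟪M.edgeNormal e, x⟫ ≤ ⟪M.edgeNormal e, y⟫ := by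
  rw [edgeNormal, dif_pos h]
  exact (M.exists_edgeNormal e h).choose_spec

theorem outNormal_spec {i j : Fin M.n} (h : i ≠ j) :
    ‖M.outNormal i j‖ = 1 ∧ ∀ x ∈ M.T i, ∀ y ∈ M.T j,
      ⟪M.outNormal i j, x⟫ ≤ ⟪M.outNormal i j, y⟫ := by
  unfold outNormal
  split_ifs
  · exact M.edgeNormal_spec (i, j) h
  · obtain ⟨h1, h2⟩ := M.edgeNormal_spec (j, i) h.symm
    refine ⟨by rwa [norm_neg], fun x hx y hy => ?_⟩
    rw [inner_neg_left, inner_neg_left]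
    exact neg_le_neg (h2 y hy x hx)

/-- At `x` all the hyperplanes of the mesh through `x` coincide. -/
def IsGeneric (x : E d) : Prop :=
  ∀ i j, ∀ H ∈ (M.elem i).halfSpaces, ∀ H' ∈ (M.elem j).halfSpaces,
    ⟪H.1, x⟫ = H.2 → ⟪H'.1, x⟫ = H'.2 → H'.1 = H.1 ∨ H'.1 = -H.1

theorem ae_isGeneric : ∀ᵐ x ∂(surface d), M.IsGeneric x := by
  simp only [IsGeneric, ae_all_iff, eventually_all_finset]
  intro i j H hH H' hH'
  by_cases h : H'.1 = H.1 ∨ H'.1 = -H.1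
  · exact Eventually.of_forall fun _ _ _ => h
  · rw [not_or] at h
    rw [ae_iff]
    refine measure_mono_null (fun x hx => ?_) (surface_inter_hyperplanes
      ((M.elem i).norm_eq_one H hH) ((M.elem j).norm_eq_one H' hH') h.1 h.2 H.2 H'.2)
    simp only [mem_ofPred_eq] at hx ⊢
    tauto

variable {M}

theorem notMem_interior_of_mem {i j : Fin M.n} (hij : i ≠ j) {x : E d} (hx : x ∈ M.T j) :
    x ∉ interior (M.T i) := by
  intro hi
  have hcl : x ∈ closure (interior (M.T j)) := by
    rw [T, (M.elem j).convex_carrier.closure_interior_eq_closure_of_nonempty_interior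
      (M.interior_nonempty j)]
    exact subset_closure hx
  obtain ⟨y, hy1, hy2⟩ := mem_closure_iff.1 hcl _ isOpen_interior hi
  exact disjoint_left.1 (M.disjoint i j hij) hy1 hy2

theorem IsGeneric.eq_of_active {x : E d} (hx : M.IsGeneric x) {i : Fin M.n} {H H' : E d × ℝ}
    (hH : H ∈ (M.elem i).halfSpaces) (hxH : ⟪H.1, x⟫ = H.2)
    (hH' : H' ∈ (M.elem i).halfSpaces) (hxH' : ⟪H'.1, x⟫ = H'.2) : H' = H :=
  (M.elem i).eq_of_active (M.interior_nonempty i) hH hH' hxH hxH' (hx i i H hH H' hH' hxH hxH')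

theorem IsGeneric.isNormalAt {x : E d} (hx : M.IsGeneric x) {i : Fin M.n} {H : E d × ℝ}
    (hxi : x ∈ M.T i) (hH : H ∈ (M.elem i).halfSpaces) (hxH : ⟪H.1, x⟫ = H.2) :
    (M.elem i).IsNormalAt x H.1 :=
  (M.elem i).isNormalAt_of_active hxi hH hxH fun _ h h' => hx.eq_of_active hH hxH h h'

/-- Another element through `x` lies locally on one side of the same hyperplane; on the same side as
`T_i` the two interiors would overlap. -/
theorem IsGeneric.isNormalAt_neg {x : E d} (hx : M.IsGeneric x) {i j : Fin M.n} (hij : i ≠ j)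
    {H : E d × ℝ} (hxi : x ∈ M.T i) (hxj : x ∈ M.T j) (hH : H ∈ (M.elem i).halfSpaces)
    (hxH : ⟪H.1, x⟫ = H.2) : (M.elem j).IsNormalAt x (-H.1) := by
  obtain ⟨H', hH', hxH'⟩ := (M.elem j).exists_active_of_notMem_interior hxj
    (notMem_interior_of_mem hij.symm hxi)
  have hn := hx.isNormalAt hxi hH hxH
  have hn' := hx.isNormalAt hxj hH' hxH'
  rcases hx i j H hH H' hH' hxH hxH' with h | h
  · rw [h] at hn'
    exact absurd (M.disjoint i j hij) (hn.not_disjoint hn')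
  · rwa [h] at hn'

open Classical in
-- At a generic point of a facet there are two cases. If a second element contains `x`, it is unique
-- and fills the other half-space, so `x` is interior to the closure of `Ω` and, there being no
-- slits, lies in `Ω`. Otherwise `closure Ω` coincides with `T_i` near `x`, and `x` lies on the
-- frontier. So exactly one term on the right survives.
theorem IsGeneric.sum_facet_eq (hΩ : interior (closure Ω) = Ω) {x : E d} (hx : M.IsGeneric x)
    (i : Fin M.n) (w : E d) :
    ∑ H ∈ (M.elem i).halfSpaces, (if x ∈ (M.elem i).facet H then ⟪H.1, w⟫ else 0) =
      ∑ H ∈ (M.elem i).halfSpaces, (if x ∈ M.bdryEdge i H then ⟪H.1, w⟫ else 0) +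
      ∑ j ∈ Finset.univ.erase i, if x ∈ M.edge (i, j) then ⟪M.outNormal i j, w⟫ else 0 := by
  by_cases hxi : x ∈ M.T i
  swap
  · have h1 : ∀ H, x ∉ (M.elem i).facet H := fun H h => hxi h.1
    have h2 : ∀ H, x ∉ M.bdryEdge i H := fun H h => hxi h.1.1
    have h3 : ∀ j, x ∉ M.edge (i, j) := fun j h => hxi h.1
    simp [h1, h2, h3]
  by_cases hact : ∃ H ∈ (M.elem i).halfSpaces, ⟪H.1, x⟫ = H.2
  swap
  · have hint : x ∈ interior (M.T i) := by
      by_contra h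
      exact hact ((M.elem i).exists_active_of_notMem_interior hxi h)
    push Not at hact
    rw [Finset.sum_eq_zero, Finset.sum_eq_zero, Finset.sum_eq_zero, add_zero]
    · exact fun j hj => if_neg fun h =>
        notMem_interior_of_mem (Finset.ne_of_mem_erase hj).symm h.2 hint
    · exact fun H hH => if_neg fun h => hact H hH h.1.2
    · exact fun H hH => if_neg fun h => hact H hH h.2
  obtain ⟨H, hH, hxH⟩ := hact
  have hn := hx.isNormalAt hxi hH hxH
  rw [Finset.sum_eq_single_of_mem H hH
    fun H' hH' hne => if_neg fun h => hne (hx.eq_of_active hH hxH hH' h.2),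
    Finset.sum_eq_single_of_mem H hH
    fun H' hH' hne => if_neg fun h => hne (hx.eq_of_active hH hxH hH' h.1.2),
    if_pos ⟨hxi, hxH⟩]
  have hsubset : ∀ j, M.T j ⊆ closure Ω := fun j => M.cover ▸ subset_iUnion M.T j
  by_cases hj : ∃ j, j ≠ i ∧ x ∈ M.T j
  · obtain ⟨j, hji, hxj⟩ := hj
    have hnj := hx.isNormalAt_neg hji.symm hxi hxj hH hxH
    have hxΩ : x ∈ Ω := by
      rw [← hΩ]
      refine mem_interior_iff_mem_nhds.2 ?_
      filter_upwards [hn.2, hnj.2] with y h1 h2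
      rcases le_total ⟪H.1, y⟫ ⟪H.1, x⟫ with h | h
      · exact hsubset i (h1.2 h)
      · exact hsubset j (h2.2 (by simpa using h))
    have hfr : x ∉ M.bdryEdge i H := by
      intro h
      have := h.2.2
      rw [← hΩ, interior_interior, hΩ] at this
      exact this hxΩ
    rw [if_neg hfr, zero_add, Finset.sum_eq_single_of_mem j
      (Finset.mem_erase.2 ⟨hji, Finset.mem_univ j⟩), if_pos ⟨hxi, hxj⟩]
    · obtain ⟨h1, h2⟩ := M.outNormal_spec hji.symm
      rw [hn.eq_of_separates h1 fun y hy => h2 y hy x hxj]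
    · intro k hk hkj
      refine if_neg fun h => ?_
      have hnk := hx.isNormalAt_neg (Finset.ne_of_mem_erase hk).symm hxi h.2 hH hxH
      exact hnj.not_disjoint hnk (M.disjoint j k hkj.symm)
  · push Not at hj
    have hfr : x ∈ M.bdryEdge i H := by
      refine ⟨⟨hxi, hxH⟩, hsubset i hxi, fun h => hn.notMem_interior ?_⟩
      have hcl : closure Ω ∈ 𝓝 x := mem_of_superset (mem_interior_iff_mem_nhds.1 h) subset_closure
      have hav : ∀ᶠ y in 𝓝 x, ∀ j, j ≠ i → y ∉ M.T j := by
        rw [eventually_all]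
        intro j
        by_cases hji : j = i
        · exact Eventually.of_forall fun _ h => absurd hji h
        · filter_upwards [(isCompact_T j).isClosed.isOpen_compl.mem_nhds (hj j hji)] with y hy _
            using hy
      refine mem_interior_iff_mem_nhds.2 ?_
      filter_upwards [hcl, hav] with y hy hy'
      rw [← M.cover] at hy
      obtain ⟨j, hyj⟩ := mem_iUnion.1 hy
      by_cases hji : j = i
      · exact hji ▸ hyj
      · exact absurd hyj (hy' j hji)
    rw [if_pos hfr, Finset.sum_eq_zero, add_zero]
    exact fun j hj' => if_neg fun h => hj j (Finset.ne_of_mem_erase hj') h.2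

theorem isCompact_edge (e : Fin M.n × Fin M.n) : IsCompact (M.edge e) :=
  (isCompact_T e.1).inter (isCompact_T e.2)

theorem surface_edge_lt_top {e : Fin M.n × Fin M.n} (h : e.1 ≠ e.2) :
    surface d (M.edge e) < ⊤ := by
  obtain ⟨ν, hν, hs⟩ := M.exists_edgeNormal e h
  exact surface_lt_top (isCompact_edge e).isBounded hν fun x hx y hy =>
    le_antisymm (hs x hx.1 y hy.2) (hs y hy.1 x hx.2)

theorem surface_facet_lt_top (T : ConvexPolytope d) {H : E d × ℝ} (hH : H ∈ T.halfSpaces) :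
    surface d (T.facet H) < ⊤ :=
  surface_lt_top (T.isCompact_facet H).isBounded (T.norm_eq_one H hH)
    fun _ hx _ hy => hx.2.trans hy.2.symm

/-- The flux through the boundary of an element, split into the flux through the boundary of `Ω`
and through the interfaces with the other elements. -/
theorem sum_integral_facet_eq (hΩ : interior (closure Ω) = Ω) (i : Fin M.n) {F : E d → E d}
    (hF : Continuous F) :
    ∑ H ∈ (M.elem i).halfSpaces, ∫ x in (M.elem i).facet H, ⟪H.1, F x⟫ ∂(surface d) =
      ∑ H ∈ (M.elem i).halfSpaces, ∫ x in M.bdryEdge i H, ⟪H.1, F x⟫ ∂(surface d) +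
      ∑ j ∈ Finset.univ.erase i,
        ∫ x in M.edge (i, j), ⟪M.outNormal i j, F x⟫ ∂(surface d) := by
  classical
  have hm1 : ∀ H, MeasurableSet ((M.elem i).facet H) := fun H =>
    ((M.elem i).isCompact_facet H).isClosed.measurableSet
  have hm2 : ∀ H, MeasurableSet (M.bdryEdge i H) := fun H =>
    (hm1 H).inter isClosed_frontier.measurableSet
  have hm3 : ∀ j, MeasurableSet (M.edge (i, j)) := fun j =>
    (isCompact_edge (i, j)).isClosed.measurableSet
  have hi1 : ∀ H ∈ (M.elem i).halfSpaces,
      IntegrableOn (fun x => ⟪H.1, F x⟫) ((M.elem i).facet H) (surface d) := fun H hH =>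
    integrableOn_of_compact ((M.elem i).isCompact_facet H) (surface_facet_lt_top _ hH)
      (by fun_prop)
  have hi2 : ∀ H ∈ (M.elem i).halfSpaces,
      IntegrableOn (fun x => ⟪H.1, F x⟫) (M.bdryEdge i H) (surface d) := fun H hH =>
    (hi1 H hH).mono_set inter_subset_left
  have hi3 : ∀ j ∈ Finset.univ.erase i,
      IntegrableOn (fun x => ⟪M.outNormal i j, F x⟫) (M.edge (i, j)) (surface d) := fun j hj =>
    integrableOn_of_compact (isCompact_edge (i, j))
      (surface_edge_lt_top (Finset.ne_of_mem_erase hj).symm) (by fun_prop)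
  simp only [← integral_indicator (hm1 _), ← integral_indicator (hm2 _),
    ← integral_indicator (hm3 _)]
  rw [← integral_finsetSum _ fun H hH => (hi1 H hH).integrable_indicator (hm1 H),
    ← integral_finsetSum _ fun H hH => (hi2 H hH).integrable_indicator (hm2 H),
    ← integral_finsetSum _ fun j hj => (hi3 j hj).integrable_indicator (hm3 j),
    ← integral_add
      (integrable_finsetSum _ fun H hH => (hi2 H hH).integrable_indicator (hm2 H))
      (integrable_finsetSum _ fun j hj => (hi3 j hj).integrable_indicator (hm3 j))]
  refine integral_congr_ae ?_
  filter_upwards [M.ae_isGeneric] with x hx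
  simpa only [indicator_apply] using hx.sum_facet_eq hΩ i (F x)

end Mesh

/-! ### Polynomials: derivatives, degrees and the inverse inequality -/

variable {d : ℕ}

/-- The function on `ℝᵈ` given by a polynomial. -/
def polyFun (q : MvPolynomial (Fin d) ℝ) (x : E d) : ℝ := MvPolynomial.eval (fun l => x l) q

theorem contDiff_polyFun (q : MvPolynomial (Fin d) ℝ) : ContDiff ℝ 1 (polyFun q) := by
  induction q using MvPolynomial.induction_on with
  | C r =>
    have : polyFun (MvPolynomial.C r) = fun _ : E d => r := by funext y; simp [polyFun]
    rw [this]
    exact contDiff_const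
  | add p q hp hq =>
    have : polyFun (p + q) = fun y : E d => polyFun p y + polyFun q y := by
      funext y; simp [polyFun]
    rw [this]
    exact hp.add hq
  | mul_X p l hp =>
    have h : polyFun (p * MvPolynomial.X l) = fun y : E d => polyFun p y * y l := by
      funext y; simp [polyFun]
    rw [h]
    exact hp.mul (by fun_prop)

@[fun_prop]
theorem continuous_polyFun (q : MvPolynomial (Fin d) ℝ) : Continuous (polyFun q) :=
  (contDiff_polyFun q).continuous

theorem fderiv_polyFun (q : MvPolynomial (Fin d) ℝ) (x : E d) (l : Fin d) :
    fderiv ℝ (polyFun q) x (EuclideanSpace.single l 1) = polyFun (MvPolynomial.pderiv l q) x := by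
  have hd : ∀ q : MvPolynomial (Fin d) ℝ, DifferentiableAt ℝ (polyFun q) x := fun q =>
    (contDiff_polyFun q).differentiable one_ne_zero x
  induction q using MvPolynomial.induction_on with
  | C r =>
    have : polyFun (MvPolynomial.C r) = fun _ : E d => r := by funext y; simp [polyFun]
    rw [this]
    simp [polyFun]
  | add p q hp hq =>
    have : polyFun (p + q) = fun y : E d => polyFun p y + polyFun q y := by
      funext y; simp [polyFun]
    rw [this, fderiv_fun_add (hd p) (hd q)]
    simp only [add_apply, hp, hq, map_add]
    simp [polyFun]
  | mul_X p m hp =>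
    have : polyFun (p * MvPolynomial.X m) = fun y : E d => polyFun p y * y m := by
      funext y; simp [polyFun]
    have hproj : HasFDerivAt (fun y : E d => y m) (EuclideanSpace.proj m : E d →L[ℝ] ℝ) x :=
      (EuclideanSpace.proj m : E d →L[ℝ] ℝ).hasFDerivAt
    rw [this, ((hd p).hasFDerivAt.fun_mul hproj).fderiv]
    simp only [add_apply, smul_apply, hp, smul_eq_mul]
    rcases eq_or_ne m l with rfl | h
    · simp [polyFun]
    · simp [polyFun, MvPolynomial.pderiv_X_of_ne h, h]

theorem totalDegree_pderiv_le {k : ℕ} {q : MvPolynomial (Fin d) ℝ} (hq : q.totalDegree ≤ k)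
    (l : Fin d) : (MvPolynomial.pderiv l q).totalDegree ≤ k := by
  rw [MvPolynomial.totalDegree, Finset.sup_le_iff] at hq ⊢
  intro m hm
  rw [MvPolynomial.mem_support_iff, MvPolynomial.coeff_pderiv] at hm
  have := hq _ (MvPolynomial.mem_support_iff.2 (left_ne_zero_of_mul hm))
  rw [Finsupp.sum_add_index' (by simp) (by simp)] at this
  omega

theorem totalDegree_aeval_le {q : MvPolynomial (Fin d) ℝ} {f : Fin d → MvPolynomial (Fin d) ℝ}
    (hf : ∀ l, (f l).totalDegree ≤ 1) : (MvPolynomial.aeval f q).totalDegree ≤ q.totalDegree := by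
  rw [MvPolynomial.aeval_def, MvPolynomial.eval₂_eq]
  refine MvPolynomial.totalDegree_finsetSum_le fun m hm => ?_
  refine (MvPolynomial.totalDegree_mul _ _).trans ?_
  rw [MvPolynomial.algebraMap_eq, MvPolynomial.totalDegree_C, zero_add]
  refine (MvPolynomial.totalDegree_finsetProd _ _).trans ?_
  refine le_trans (Finset.sum_le_sum fun l _ => ?_) (MvPolynomial.le_totalDegree hm)
  exact (MvPolynomial.totalDegree_pow _ _).trans (mul_le_of_le_one_right (Nat.zero_le _) (hf l))

theorem eq_zero_of_integral_sq_eq_zero {K : Set (E d)} (hK : IsCompact K)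
    (hKi : (interior K).Nonempty) {q : MvPolynomial (Fin d) ℝ}
    (h : ∫ x in K, polyFun q x * polyFun q x = 0) : q = 0 := by
  rw [setIntegral_eq_zero_iff_of_nonneg_ae
    (Filter.Eventually.of_forall fun x => mul_self_nonneg (polyFun q x))
    (Mesh.integrableOn_of_compact hK hK.measure_lt_top (by fun_prop))] at h
  have hz : ∀ x ∈ interior K, polyFun q x = 0 := by
    have h1 : (fun x => polyFun q x * polyFun q x) =ᵐ[volume.restrict (interior K)] 0 :=
      ae_restrict_of_ae_restrict_of_subset interior_subset h
    have h2 := Measure.eqOn_open_of_ae_eq h1 isOpen_interior (by fun_prop) (by fun_prop)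
    exact fun x hx => mul_self_eq_zero.1 (h2 hx)
  obtain ⟨c, hc⟩ := hKi
  obtain ⟨r, hr, hball⟩ : ∃ r > 0, Set.pi univ (fun l => Metric.ball (c l) r) ⊆
      {y : Fin d → ℝ | WithLp.toLp 2 y ∈ interior K} := by
    have hopen : IsOpen {y : Fin d → ℝ | WithLp.toLp 2 y ∈ interior K} :=
      isOpen_interior.preimage (by fun_prop)
    obtain ⟨r, hr, hb⟩ := Metric.isOpen_iff.1 hopen (fun l => c l) hc
    exact ⟨r, hr, by rwa [ball_pi _ hr] at hb⟩
  refine MvPolynomial.funext_set (fun l => Metric.ball (c l) r) (fun l => ?_) fun x hx => ?_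
  · exact infinite_of_mem_nhds (c l) (Metric.ball_mem_nhds _ hr)
  · have := hz _ (hball hx)
    simpa [polyFun] using this

/-- Stated for abstract spaces so that it applies to polynomials with the `L²(K)` inner product,
whose instances are supplied by hand. -/
theorem exists_norm_sq_le {V W : Type*} [NormedAddCommGroup V] [InnerProductSpace ℝ V]
    [FiniteDimensional ℝ V] [NormedAddCommGroup W] [NormedSpace ℝ W] (L : V →ₗ[ℝ] W) :
    ∃ C : ℝ, 0 < C ∧ ∀ f : V, ‖L f‖ ^ 2 ≤ C * ⟪f, f⟫ := by
  let L' : V →L[ℝ] W := L.toContinuousLinearMap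
  refine ⟨‖L'‖ ^ 2 + 1, by positivity, fun f => ?_⟩
  rw [real_inner_self_eq_norm_sq]
  calc ‖L f‖ ^ 2 ≤ (‖L'‖ * ‖f‖) ^ 2 := by gcongr; exact L'.le_opNorm f
    _ ≤ (‖L'‖ ^ 2 + 1) * ‖f‖ ^ 2 := by nlinarith [sq_nonneg ‖f‖]

/-- On the finite dimensional space of polynomials of degree at most `k`, the `L²(K)` inner product
is definite because `K` has interior, so its norm controls the sup norm on `K'`. -/
theorem exists_sq_le_integral_sq (d k : ℕ) {K K' : Set (E d)} (hK : IsCompact K)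
    (hK' : IsCompact K') (hKi : (interior K).Nonempty) :
    ∃ C : ℝ, 0 < C ∧ ∀ q : MvPolynomial (Fin d) ℝ, q.totalDegree ≤ k → ∀ x ∈ K',
      polyFun q x ^ 2 ≤ C * ∫ y in K, polyFun q y * polyFun q y := by
  let V := MvPolynomial.restrictTotalDegree (Fin d) ℝ k
  have hint : ∀ f g : V, IntegrableOn (fun y => polyFun f.1 y * polyFun g.1 y) K := fun f g =>
    Mesh.integrableOn_of_compact hK hK.measure_lt_top (by fun_prop)
  have hadd : ∀ (f g : V) (y : E d), polyFun (f + g).1 y = polyFun f.1 y + polyFun g.1 y := by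
    intro f g y; simp [polyFun]
  have hsmul : ∀ (r : ℝ) (f : V) (y : E d), polyFun (r • f).1 y = r * polyFun f.1 y := by
    intro r f y; simp [polyFun]
  let core : InnerProductSpace.Core ℝ V :=
    { inner := fun f g => ∫ y in K, polyFun f.1 y * polyFun g.1 y
      conj_inner_symm := fun f g => by simp [mul_comm]
      re_inner_nonneg := fun f => by
        simpa using integral_nonneg fun y => mul_self_nonneg (polyFun f.1 y)
      add_left := fun f g h => by
        simp only [hadd, add_mul]
        exact integral_add (hint f h) (hint g h)
      smul_left := fun f g r => by
        simp only [hsmul, mul_assoc, integral_const_mul]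
        rfl
      definite := fun f hf => Subtype.ext (eq_zero_of_integral_sq_eq_zero hK hKi hf) }
  have : CompactSpace K' := isCompact_iff_compactSpace.1 hK'
  let L : V →ₗ[ℝ] C(K', ℝ) :=
    { toFun := fun f => ⟨fun x => polyFun f.1 x, by fun_prop⟩
      map_add' := fun f g => by ext x; exact hadd f g x
      map_smul' := fun r f => by ext x; exact hsmul r f x }
  obtain ⟨C, hC, hCL⟩ := @exists_norm_sq_le V C(K', ℝ) core.toNormedAddCommGroup
    (InnerProductSpace.ofCore core.toCore) inferInstance _ _ L
  refine ⟨C, hC, fun q hq x hx => ?_⟩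
  let f : V := ⟨q, (MvPolynomial.mem_restrictTotalDegree _ _ q).2 hq⟩
  have h1 : |polyFun q x| ≤ ‖L f‖ := (L f).norm_coe_le_norm ⟨x, hx⟩
  rw [← sq_abs]
  exact (pow_le_pow_left₀ (abs_nonneg _) h1 2).trans (hCL f)

open scoped Pointwise in
/-- The inverse inequality for polynomials on balls of comparable radii. -/
theorem exists_inverse_inequality (d k : ℕ) {σ : ℝ} (hσ : 0 < σ) :
    ∃ C : ℝ, 0 < C ∧ ∀ q : MvPolynomial (Fin d) ℝ, q.totalDegree ≤ k →
      ∀ (x₀ : E d) (h : ℝ), 0 < h → ∀ x ∈ Metric.closedBall x₀ h, h ^ d * polyFun q x ^ 2 ≤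
        C * ∫ y in Metric.closedBall x₀ (σ * h), polyFun q y * polyFun q y := by
  obtain ⟨C, hC, hC'⟩ := exists_sq_le_integral_sq d k (isCompact_closedBall (0 : E d) σ)
    (isCompact_closedBall (0 : E d) 1)
    ⟨0, Metric.ball_subset_interior_closedBall (Metric.mem_ball_self hσ)⟩
  refine ⟨C, hC, fun q hq x₀ h hh x hx => ?_⟩
  -- Pulling back by `y ↦ x₀ + h y` does not raise the degree and reduces to the balls of radius `σ`
  -- and `1` about the origin; the change of variables produces `h ^ d`.
  let q' : MvPolynomial (Fin d) ℝ := MvPolynomial.aeval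
    (fun l => MvPolynomial.C (x₀ l) + MvPolynomial.C h * MvPolynomial.X l) q
  have hq' : q'.totalDegree ≤ k := by
    refine (totalDegree_aeval_le fun l => ?_).trans hq
    refine (MvPolynomial.totalDegree_add _ _).trans (max_le (by simp) ?_)
    refine (MvPolynomial.totalDegree_mul _ _).trans (by simp)
  have hev : ∀ y : E d, polyFun q' y = polyFun q (x₀ + h • y) := by
    intro y
    change MvPolynomial.eval _ (MvPolynomial.bind₁ _ q) = _
    rw [← MvPolynomial.coe_aeval_eq_eval, RingHom.coe_coe, MvPolynomial.aeval_bind₁]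
    simp [polyFun, MvPolynomial.aeval_eq_eval]
  have hscale : ∫ y in Metric.closedBall (0 : E d) σ, polyFun q' y * polyFun q' y =
      (h ^ d)⁻¹ * ∫ y in Metric.closedBall x₀ (σ * h), polyFun q y * polyFun q y := by
    simp only [hev]
    have h1 := Measure.setIntegral_comp_smul_of_pos volume
      (fun y : E d => polyFun q (x₀ + y) * polyFun q (x₀ + y)) (Metric.closedBall (0 : E d) σ) hh
    have h2 : h • Metric.closedBall (0 : E d) σ = (x₀ + ·) ⁻¹' Metric.closedBall x₀ (σ * h) := by
      rw [smul_closedBall' hh.ne', smul_zero, Real.norm_of_nonneg hh.le, mul_comm h]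
      simp [preimage_add_closedBall]
    rw [h1, h2, (measurePreserving_add_left volume x₀).setIntegral_preimage_emb
      (measurableEmbedding_addLeft x₀) (fun y => polyFun q y * polyFun q y)]
    simp
  have hx' : h⁻¹ • (x - x₀) ∈ Metric.closedBall (0 : E d) 1 := by
    rw [mem_closedBall_zero_iff, norm_smul, norm_inv, Real.norm_of_nonneg hh.le,
      inv_mul_le_iff₀ hh, mul_one]
    exact mem_closedBall_iff_norm.1 hx
  have h2 := hC' q' hq' _ hx'
  rw [hscale, hev, smul_inv_smul₀ hh.ne', add_sub_cancel] at h2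
  have hp : 0 < h ^ d := by positivity
  calc h ^ d * polyFun q x ^ 2 ≤ h ^ d * (C * ((h ^ d)⁻¹ *
      ∫ y in Metric.closedBall x₀ (σ * h), polyFun q y * polyFun q y)) := by gcongr
    _ = _ := by field_simp

/-! ### The defect between numerical and piecewise derivatives -/

namespace Mesh

variable {d : ℕ} {Ω : Set (E d)} {M : Mesh Ω} {k : ℕ}

theorem sum_sum_erase {ι : Type*} [Fintype ι] [LinearOrder ι] (A : ι → ι → ℝ) :
    ∑ i, ∑ j ∈ Finset.univ.erase i, A i j =
      ∑ e ∈ Finset.univ.filter (fun e : ι × ι => e.1 < e.2), (A e.1 e.2 + A e.2 e.1) := by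
  have h1 : ∑ i, ∑ j ∈ Finset.univ.erase i, A i j =
      ∑ e : ι × ι, ((if e.1 < e.2 then A e.1 e.2 else 0) + if e.2 < e.1 then A e.1 e.2 else 0) := by
    rw [Fintype.sum_prod_type]
    refine Finset.sum_congr rfl fun i _ => ?_
    rw [← Finset.sum_erase Finset.univ (a := i) (by simp)]
    refine Finset.sum_congr rfl fun j hj => ?_
    rcases lt_or_gt_of_ne (Finset.ne_of_mem_erase hj) with h | h
    · simp [h, h.not_gt]
    · simp [h, h.not_gt]
  rw [h1, Finset.sum_add_distrib, Finset.sum_add_distrib, Finset.sum_filter, Finset.sum_filter]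
  congr 1
  rw [← (Equiv.prodComm ι ι).sum_comp]
  rfl

theorem edge_swap (i j : Fin M.n) : M.edge (i, j) = M.edge (j, i) := inter_comm _ _

/-- Each unordered pair is visited from both sides, and pairs whose intersection has surface measure
zero contribute nothing, so only interior edges remain. -/
theorem sum_integral_edge (G : Fin M.n → Fin M.n → E d → ℝ) :
    ∑ i, ∑ j ∈ Finset.univ.erase i, ∫ x in M.edge (i, j), G i j x ∂(surface d) =
      ∑ e ∈ M.interiorEdges, (∫ x in M.edge e, G e.1 e.2 x ∂(surface d) +
        ∫ x in M.edge e, G e.2 e.1 x ∂(surface d)) := by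
  classical
  rw [sum_sum_erase, interiorEdges, ← Finset.filter_filter]
  symm
  rw [Finset.sum_filter_of_ne]
  · refine Finset.sum_congr rfl fun e _ => ?_
    rw [edge_swap e.2 e.1]
  · intro e _ hne
    by_contra h
    have h0 : surface d (M.edge e) = 0 := by simpa using h
    simp [Measure.restrict_eq_zero.2 h0] at hne

theorem outNormal_of_mem {e : Fin M.n × Fin M.n} (he : e ∈ M.interiorEdges) :
    M.outNormal e.1 e.2 = M.edgeNormal e ∧ M.outNormal e.2 e.1 = -M.edgeNormal e := by
  simp only [interiorEdges, Finset.mem_filter] at he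
  simp [outNormal, he.2.1, he.2.1.not_gt]

theorem massForm_sidedDeriv (s : ℝ) (l : Fin d) (v φ : M.DGSpace k) :
    massForm (sidedDeriv s l v) φ = numDerivRHS s l v φ :=
  (existsUnique_numDeriv s l v).exists.choose_spec φ

/-- The elementwise partial derivative, as a member of `V_h`. -/
def pwDeriv (l : Fin d) (v : M.DGSpace k) : M.DGSpace k := fun i =>
  ⟨MvPolynomial.pderiv l (v i : MvPolynomial (Fin d) ℝ),
    (MvPolynomial.mem_restrictTotalDegree _ _ _).2
      (totalDegree_pderiv_le ((MvPolynomial.mem_restrictTotalDegree _ _ _).1 (v i).2) l)⟩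

/-- The divergence theorem for the polynomial `v φ` in the coordinate direction `l`, with the flux
split by `sum_integral_facet_eq`. -/
theorem integral_val_mul_dval (hΩ : interior (closure Ω) = Ω) (l : Fin d) (v φ : M.DGSpace k)
    (i : Fin M.n) :
    (∫ x in M.T i, dval l v i x * val φ i x) + ∫ x in M.T i, val v i x * dval l φ i x =
      ∑ H ∈ (M.elem i).halfSpaces,
        ∫ x in M.bdryEdge i H, val v i x * H.1 l * val φ i x ∂(surface d) +
      ∑ j ∈ Finset.univ.erase i,
        ∫ x in M.edge (i, j), val v i x * M.outNormal i j l * val φ i x ∂(surface d) := by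
  let q : MvPolynomial (Fin d) ℝ := v i * φ i
  have hq : ∀ x, polyFun q x = val v i x * val φ i x := fun x => by simp [q, polyFun, val]
  have hdiv := (M.elem i).integral_fderiv_eq_sum_facet (M.interior_nonempty i)
    (contDiff_polyFun q) (EuclideanSpace.single l 1)
  have hflux := M.sum_integral_facet_eq hΩ i
    (F := fun x => polyFun q x • EuclideanSpace.single l (1 : ℝ)) (by fun_prop)
  have hinner : ∀ a x : E d, ⟪a, polyFun q x • EuclideanSpace.single l (1 : ℝ)⟫ =
      val v i x * a l * val φ i x := by
    intro a x
    rw [inner_smul_right, hq, EuclideanSpace.inner_single_right]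
    simp
    ring
  simp only [hinner] at hflux
  rw [← hflux, ← integral_add (integrableOn_T i (by fun_prop)) (integrableOn_T i (by fun_prop))]
  have hd : ∀ x, fderiv ℝ (polyFun q) x (EuclideanSpace.single l 1) =
      dval l v i x * val φ i x + val v i x * dval l φ i x := by
    intro x
    rw [fderiv_polyFun]
    simp [q, polyFun, val, dval]
    ring
  simp only [hd] at hdiv
  refine hdiv.trans (Finset.sum_congr rfl fun H _ => ?_)
  rw [EuclideanSpace.inner_single_right, ← integral_const_mul]
  refine integral_congr_ae (Filter.Eventually.of_forall fun x => ?_)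
  simp [hq]
  ring

/-- In the mean of the two one-sided forms the `sgn` terms cancel. Subtracting the elementwise
integration by parts removes the volume and boundary terms and leaves `{v} - v_i = -(v_i - v_j)/2`
on each interface. -/
theorem massForm_numDeriv_sub (hΩ : interior (closure Ω) = Ω) (l : Fin d) (v φ : M.DGSpace k) :
    massForm (numDeriv l v - pwDeriv l v) φ =
      -∑ i, ∑ j ∈ Finset.univ.erase i, ∫ x in M.edge (i, j),
        (val v i x - val v j x) / 2 * M.outNormal i j l * val φ i x ∂(surface d) := by
  have hnum : massForm (numDeriv l v) φ =
      ∑ i, ∑ j ∈ Finset.univ.erase i, ∫ x in M.edge (i, j),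
        (val v i x + val v j x) / 2 * M.outNormal i j l * val φ i x ∂(surface d)
      + (∑ i, ∑ H ∈ (M.elem i).halfSpaces,
        ∫ x in M.bdryEdge i H, val v i x * H.1 l * val φ i x ∂(surface d))
      - ∑ i, ∫ x in M.T i, val v i x * dval l φ i x := by
    rw [numDeriv, massForm_smul_left, massForm_add_left, massForm_sidedDeriv, massForm_sidedDeriv,
      sum_integral_edge fun i j x => (val v i x + val v j x) / 2 * M.outNormal i j l * val φ i x]
    have hedge : ∀ e ∈ M.interiorEdges,
        (∫ x in M.edge e, (val v e.1 x + val v e.2 x) / 2 * M.outNormal e.1 e.2 l * val φ e.1 x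
            ∂(surface d))
          + ∫ x in M.edge e, (val v e.2 x + val v e.1 x) / 2 * M.outNormal e.2 e.1 l * val φ e.2 x
            ∂(surface d)
        = 1 / 2 * ((∫ x in M.edge e, traceOp 1 l v e x * M.edgeNormal e l * jump φ e x ∂(surface d))
          + ∫ x in M.edge e, traceOp (-1) l v e x * M.edgeNormal e l * jump φ e x
            ∂(surface d)) := by
      intro e he
      rw [← integral_add (integrableOn_edge e he (by fun_prop))
          (integrableOn_edge e he (by fun_prop)),
        ← integral_add (integrableOn_edge e he (by fun_prop))
          (integrableOn_edge e he (by fun_prop)), ← integral_const_mul,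
        (outNormal_of_mem he).1, (outNormal_of_mem he).2]
      congr 1
      funext x
      simp only [traceOp, avg, jump, PiLp.neg_apply]
      ring
    rw [Finset.sum_congr rfl hedge, ← Finset.mul_sum, Finset.sum_add_distrib]
    unfold numDerivRHS
    ring
  have hpw : massForm (pwDeriv l v) φ = ∑ i, ∫ x in M.T i, dval l v i x * val φ i x := rfl
  have hsub : massForm (numDeriv l v - pwDeriv l v) φ =
      massForm (numDeriv l v) φ - massForm (pwDeriv l v) φ := by
    rw [eq_sub_iff_add_eq, ← massForm_add_left, sub_add_cancel]
  rw [hsub, hnum, hpw, ← Finset.sum_add_distrib, ← Finset.sum_sub_distrib,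
    ← Finset.sum_sub_distrib, ← Finset.sum_neg_distrib]
  refine Finset.sum_congr rfl fun i _ => ?_
  have hibp := integral_val_mul_dval hΩ l v φ i
  have hjump : ∀ j ∈ Finset.univ.erase i,
      (∫ x in M.edge (i, j), (val v i x - val v j x) / 2 * M.outNormal i j l * val φ i x
        ∂(surface d)) =
      (∫ x in M.edge (i, j), val v i x * M.outNormal i j l * val φ i x ∂(surface d)) -
      ∫ x in M.edge (i, j), (val v i x + val v j x) / 2 * M.outNormal i j l * val φ i x
        ∂(surface d) := by
    intro j hj
    have hfin := surface_edge_lt_top (e := (i, j)) (Finset.ne_of_mem_erase hj).symm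
    rw [← integral_sub
      (integrableOn_of_compact (isCompact_edge (i, j)) hfin (by fun_prop))
      (integrableOn_of_compact (isCompact_edge (i, j)) hfin (by fun_prop))]
    congr 1
    funext x
    ring
  rw [Finset.sum_congr rfl hjump, Finset.sum_sub_distrib]
  linarith

/-- The defect of the numerical derivative on one element, tested with a polynomial. -/
theorem integral_defect_mul (hΩ : interior (closure Ω) = Ω) (l : Fin d) (v : M.DGSpace k)
    (i : Fin M.n) (q : MvPolynomial.restrictTotalDegree (Fin d) ℝ k) :
    ∫ x in M.T i, val (numDeriv l v - pwDeriv l v) i x * polyFun q.1 x =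
      -∑ j ∈ Finset.univ.erase i, ∫ x in M.edge (i, j),
        (val v i x - val v j x) / 2 * M.outNormal i j l * polyFun q.1 x ∂(surface d) := by
  -- Without continuity between elements, a polynomial on one element extended by zero is an
  -- admissible test function.
  have h := massForm_numDeriv_sub hΩ l v (Pi.single i q : M.DGSpace k)
  have hi : ∀ x, val (Pi.single i q : M.DGSpace k) i x = polyFun q.1 x := fun x => by
    simp [val, polyFun]
  have hne : ∀ j, j ≠ i → ∀ x, val (Pi.single i q : M.DGSpace k) j x = 0 := fun j hj x => by
    simp [val, hj]
  rw [massForm, Finset.sum_eq_single i (fun j _ hj => by simp [hne j hj]) (by simp),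
    Finset.sum_eq_single i (fun j _ hj => by simp [hne j hj]) (by simp)] at h
  simpa only [hi] using h

/-! ### Interface area and Jensen's inequality for the jumps -/

theorem rpow_tangent_le {p f s : ℝ} (hp : 1 ≤ p) (hf : 0 ≤ f) (hs : 0 < s) :
    s ^ p + p * s ^ (p - 1) * (f - s) ≤ f ^ p := by
  have h := one_add_mul_self_le_rpow_one_add (s := f / s - 1)
    (by have := div_nonneg hf hs.le; linarith) hp
  rw [add_sub_cancel, Real.div_rpow hf hs.le, le_div_iff₀ (Real.rpow_pos_of_pos hs p)] at h
  refine le_trans (le_of_eq ?_) h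
  have h1 : s ^ p = s ^ (p - 1) * s := by
    rw [← Real.rpow_add_one hs.ne', sub_add_cancel]
  rw [h1]
  field_simp

/-- The `L¹` norm of the jumps of `v` over the boundary of `T_i`. -/
def jumpL1 (v : M.DGSpace k) (i : Fin M.n) : ℝ :=
  ∑ j ∈ Finset.univ.erase i, ∫ x in M.edge (i, j), |val v i x - val v j x| ∂(surface d)

/-- The `p`-th power of the `L^p` norm of the jumps of `v` over the boundary of `T_i`. -/
def jumpLp (p : ℝ) (v : M.DGSpace k) (i : Fin M.n) : ℝ :=
  ∑ j ∈ Finset.univ.erase i, ∫ x in M.edge (i, j), |val v i x - val v j x| ^ p ∂(surface d)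

theorem jumpL1_nonneg (v : M.DGSpace k) (i : Fin M.n) : 0 ≤ jumpL1 v i :=
  Finset.sum_nonneg fun _ _ => integral_nonneg fun _ => abs_nonneg _

theorem jumpLp_nonneg (p : ℝ) (v : M.DGSpace k) (i : Fin M.n) : 0 ≤ jumpLp p v i :=
  Finset.sum_nonneg fun _ _ => integral_nonneg fun _ => Real.rpow_nonneg (abs_nonneg _) _

/-- The surface measure of the part of the boundary of `T_i` shared with other elements. -/
def interfaceArea (M : Mesh Ω) (i : Fin M.n) : ℝ :=
  ∑ j ∈ Finset.univ.erase i, (surface d).real (M.edge (i, j))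

theorem hT_pos (hd : 1 ≤ d) (i : Fin M.n) : 0 < M.hT i := by
  have : Nonempty (Fin d) := ⟨⟨0, hd⟩⟩
  obtain ⟨c, hc⟩ := M.interior_nonempty i
  have hinf : (M.T i).Infinite :=
    infinite_of_mem_nhds c (mem_interior_iff_mem_nhds.1 hc)
  exact Metric.diam_pos hinf.nontrivial (isCompact_T i).isBounded

theorem T_subset_closedBall {i : Fin M.n} {x₀ : E d} (h : x₀ ∈ M.T i) :
    M.T i ⊆ Metric.closedBall x₀ (M.hT i) := fun _ hy =>
  Metric.dist_le_diam_of_mem (isCompact_T i).isBounded hy h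

theorem volume_T_le {i : Fin M.n} {x₀ : E d} (h : x₀ ∈ M.T i) :
    volume.real (M.T i) ≤ M.hT i ^ d * volume.real (Metric.ball (0 : E d) 1) := by
  refine (measureReal_mono (T_subset_closedBall h)
    (isCompact_closedBall _ _).measure_lt_top.ne).trans (le_of_eq ?_)
  rw [Measure.addHaar_real_closedBall _ _ (show 0 ≤ M.hT i from Metric.diam_nonneg)]
  simp

theorem le_inner_of_closedBall_subset {i : Fin M.n} {x₀ : E d} {r : ℝ} (hr : 0 ≤ r)
    (hball : Metric.closedBall x₀ r ⊆ M.T i) {a x : E d} (ha : ‖a‖ = 1)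
    (hax : ∀ y ∈ M.T i, ⟪a, y⟫ ≤ ⟪a, x⟫) : r ≤ ⟪a, x - x₀⟫ := by
  have h := hax (x₀ + r • a) (hball (by simp [norm_smul, ha, abs_of_nonneg hr]))
  rw [inner_add_right, inner_smul_right, real_inner_self_eq_norm_sq, ha] at h
  rw [inner_sub_right]
  linarith

/-- The flux of `x - x₀` through the boundary of `T_i` is `d` times its volume. Every supporting
hyperplane stays at distance at least `r` from `x₀`, so the normal component is at least `r` on the
interfaces and nonnegative on the rest. -/
theorem mul_interfaceArea_le (hΩ : interior (closure Ω) = Ω) {i : Fin M.n} {x₀ : E d} {r : ℝ}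
    (hr : 0 ≤ r) (hball : Metric.closedBall x₀ r ⊆ M.T i) :
    r * interfaceArea M i ≤ d * volume.real (M.T i) := by
  have hdiv : (d : ℝ) * volume.real (M.T i) = ∑ H ∈ (M.elem i).halfSpaces,
      ∫ x in (M.elem i).facet H, ⟪H.1, x - x₀⟫ ∂(surface d) := by
    have hl : ∀ l : Fin d, volume.real (M.T i) = ∑ H ∈ (M.elem i).halfSpaces,
        ∫ x in (M.elem i).facet H, H.1 l * (x l - x₀ l) ∂(surface d) := by
      intro l
      have h := (M.elem i).integral_fderiv_eq_sum_facet (M.interior_nonempty i)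
        (f := fun x : E d => x l - x₀ l) (by fun_prop) (EuclideanSpace.single l 1)
      have hf : ∀ x : E d, fderiv ℝ (fun x : E d => x l - x₀ l) x (EuclideanSpace.single l 1)
          = 1 := by
        intro x
        have : HasFDerivAt (fun x : E d => x l - x₀ l)
            (EuclideanSpace.proj l : E d →L[ℝ] ℝ) x :=
          (EuclideanSpace.proj l : E d →L[ℝ] ℝ).hasFDerivAt.sub_const _
        rw [this.fderiv]
        simp
      simp only [hf, integral_const, smul_eq_mul, mul_one, measureReal_restrict_apply_univ] at h
      rw [T, h]
      refine Finset.sum_congr rfl fun H _ => ?_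
      rw [integral_const_mul, EuclideanSpace.inner_single_right]
      simp
    calc (d : ℝ) * volume.real (M.T i) = ∑ _l : Fin d, volume.real (M.T i) := by simp
      _ = ∑ l : Fin d, ∑ H ∈ (M.elem i).halfSpaces,
          ∫ x in (M.elem i).facet H, H.1 l * (x l - x₀ l) ∂(surface d) :=
        Finset.sum_congr rfl fun l _ => hl l
      _ = _ := by
        rw [Finset.sum_comm]
        refine Finset.sum_congr rfl fun H hH => ?_
        rw [← integral_finsetSum _ fun l _ => integrableOn_of_compact
          ((M.elem i).isCompact_facet H) (surface_facet_lt_top _ hH) (by fun_prop)]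
        congr 1
        funext x
        simp [PiLp.inner_apply, mul_comm]
  rw [hdiv, M.sum_integral_facet_eq hΩ i (F := fun x => x - x₀) (by fun_prop), interfaceArea,
    Finset.mul_sum]
  refine le_add_of_nonneg_of_le (Finset.sum_nonneg fun H hH => ?_)
    (Finset.sum_le_sum fun j hj => ?_)
  · have hm : MeasurableSet (M.bdryEdge i H) :=
      (((M.elem i).isCompact_facet H).isClosed.inter isClosed_frontier).measurableSet
    refine setIntegral_nonneg hm fun x hx => ?_
    refine hr.trans (le_inner_of_closedBall_subset hr hball ((M.elem i).norm_eq_one H hH)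
      fun y hy => ?_)
    rw [hx.1.2]
    exact hy H hH
  · have hij : i ≠ j := (Finset.ne_of_mem_erase hj).symm
    have hfin := surface_edge_lt_top (e := (i, j)) hij
    obtain ⟨h1, h2⟩ := M.outNormal_spec hij
    calc r * (surface d).real (M.edge (i, j)) = ∫ _x in M.edge (i, j), r ∂(surface d) := by
          simp [mul_comm]
      _ ≤ _ := by
        refine setIntegral_mono_on (integrableOn_const hfin.ne)
          (integrableOn_of_compact (isCompact_edge (i, j)) hfin (by fun_prop))
          (isCompact_edge (i, j)).isClosed.measurableSet fun x hx => ?_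
        exact le_inner_of_closedBall_subset hr hball h1 fun y hy => h2 y hy x hx.2

/-- Jensen's inequality on all interfaces of `T_i` at once: integrate the tangent line of `t ↦ t ^
p` at `s = J₁ / a`. Since `J₁ = s a`, the result is `s ^ p a + (p - 1) s ^ p (a - A)` with `A` the
interface area, and the last term is nonnegative. -/
theorem rpow_jumpL1_div_le {p a : ℝ} (hp : 1 < p) (v : M.DGSpace k) (i : Fin M.n) (ha : 0 < a)
    (hA : interfaceArea M i ≤ a) : (jumpL1 v i / a) ^ p * a ≤ jumpLp p v i := by
  rcases (jumpL1_nonneg v i).eq_or_lt with h0 | h0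
  · rw [← h0, zero_div, Real.zero_rpow (by linarith), zero_mul]
    exact jumpLp_nonneg p v i
  set s := jumpL1 v i / a with hs
  have hs0 : 0 < s := div_pos h0 ha
  have hlow : s ^ p * interfaceArea M i + p * s ^ (p - 1) * (jumpL1 v i - s * interfaceArea M i)
      ≤ jumpLp p v i := by
    have hsum : s ^ p * interfaceArea M i
        + p * s ^ (p - 1) * (jumpL1 v i - s * interfaceArea M i) =
        ∑ j ∈ Finset.univ.erase i, ∫ x in M.edge (i, j),
          (s ^ p + p * s ^ (p - 1) * (|val v i x - val v j x| - s)) ∂(surface d) := by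
      rw [interfaceArea, jumpL1, Finset.mul_sum, Finset.mul_sum, ← Finset.sum_sub_distrib,
        Finset.mul_sum, ← Finset.sum_add_distrib]
      refine Finset.sum_congr rfl fun j hj => ?_
      have hfin := surface_edge_lt_top (e := (i, j)) (Finset.ne_of_mem_erase hj).symm
      have hc : IntegrableOn (fun x => |val v i x - val v j x|) (M.edge (i, j)) (surface d) :=
        integrableOn_of_compact (isCompact_edge (i, j)) hfin (by fun_prop)
      have hk : ∀ c : ℝ, Integrable (fun _ : E d => c) ((surface d).restrict (M.edge (i, j))) :=
        fun c => integrableOn_const hfin.ne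
      have hcs : Integrable (fun x => |val v i x - val v j x| - s)
          ((surface d).restrict (M.edge (i, j))) := hc.sub (hk s)
      rw [integral_add (hk _) (hcs.const_mul _), integral_const_mul,
        integral_sub hc (hk s)]
      simp [mul_comm]
    rw [hsum]
    refine Finset.sum_le_sum fun j hj => ?_
    have hfin := surface_edge_lt_top (e := (i, j)) (Finset.ne_of_mem_erase hj).symm
    refine setIntegral_mono (integrableOn_of_compact (isCompact_edge (i, j)) hfin (by fun_prop))
      (integrableOn_of_compact (isCompact_edge (i, j)) hfin ?_) fun x => ?_
    · exact Continuous.rpow_const (by fun_prop) fun _ => Or.inr (by linarith)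
    · exact rpow_tangent_le hp.le (abs_nonneg _) hs0
  refine le_trans ?_ hlow
  have h1 : s ^ p = s ^ (p - 1) * s := by rw [← Real.rpow_add_one hs0.ne', sub_add_cancel]
  have h2 : jumpL1 v i = s * a := by rw [hs, div_mul_cancel₀ _ ha.ne']
  rw [h1, h2]
  have h3 : 0 ≤ s ^ (p - 1) * s * (p - 1) * (a - interfaceArea M i) :=
    mul_nonneg (mul_nonneg (mul_nonneg (Real.rpow_nonneg hs0.le _) hs0.le) (by linarith))
      (by linarith)
  nlinarith [h3]

/-! ### Local estimate of the gradient on one element -/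

theorem exists_abs_defect_le (d k : ℕ) (hd : 1 ≤ d) {σ : ℝ} (hσ : 0 < σ) :
    ∃ C : ℝ, 0 < C ∧ ∀ (Ω : Set (E d)), interior (closure Ω) = Ω → ∀ M : Mesh Ω,
      M.ShapeRegular σ → ∀ (v : M.DGSpace k) (l : Fin d) (i : Fin M.n), ∀ x ∈ M.T i,
        M.hT i ^ d * |val (numDeriv l v - pwDeriv l v) i x| ≤ C * jumpL1 v i := by
  obtain ⟨C, hC, hinv⟩ := exists_inverse_inequality d k hσ
  refine ⟨C, hC, fun Ω hΩ M hM v l i => ?_⟩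
  obtain ⟨x₀, hball⟩ := hM i
  have hh := hT_pos hd i
  have hx₀ : x₀ ∈ M.T i := hball (Metric.mem_closedBall_self (by positivity))
  set w := numDeriv l v - pwDeriv l v with hw
  obtain ⟨y, hy, hmax⟩ := (isCompact_T i).exists_isMaxOn ⟨x₀, hx₀⟩
    (f := fun x => |val w i x|) (by fun_prop)
  set B := |val w i y| with hB
  have hB0 : 0 ≤ B := abs_nonneg _
  have hmax' : ∀ x ∈ M.T i, |val w i x| ≤ B := fun x hx => hmax hx
  have hsq : ∫ x in M.T i, val w i x * val w i x ≤ jumpL1 v i * B := by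
    -- The defect is itself a polynomial of degree at most `k`, hence its own test function.
    have h := integral_defect_mul hΩ l v i (w i)
    have h' : ∫ x in M.T i, val w i x * val w i x = _ := h
    rw [h', ← Finset.sum_neg_distrib, jumpL1, Finset.sum_mul]
    refine Finset.sum_le_sum fun j hj => ?_
    have hij : i ≠ j := (Finset.ne_of_mem_erase hj).symm
    have hfin := surface_edge_lt_top (e := (i, j)) hij
    rw [← integral_neg, ← integral_mul_const]
    refine setIntegral_mono_on
      (integrableOn_of_compact (isCompact_edge (i, j)) hfin (by fun_prop))
      (integrableOn_of_compact (isCompact_edge (i, j)) hfin (by fun_prop))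
      (isCompact_edge (i, j)).isClosed.measurableSet fun x hx => ?_
    have hn : |M.outNormal i j l| ≤ 1 := by
      rw [← (M.outNormal_spec hij).1]
      exact PiLp.norm_apply_le (M.outNormal i j) l
    have hb : |polyFun (w i).1 x| ≤ B := hmax' x hx.1
    refine (neg_le_abs _).trans ?_
    rw [abs_mul, abs_mul, abs_div, abs_two]
    have h0 := abs_nonneg (val v i x - val v j x)
    calc |val v i x - val v j x| / 2 * |M.outNormal i j l| * |polyFun (w i).1 x|
        ≤ |val v i x - val v j x| * 1 * B := by gcongr; linarith
      _ = _ := by ring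
  -- `T_i` lies between the concentric balls of radii `σ h` and `h` about `x₀`, as the inverse
  -- inequality requires; one factor `B` is divided out at the end.
  have hkey : M.hT i ^ d * B ^ 2 ≤ C * (jumpL1 v i * B) := by
    have h1 := hinv (w i).1 ((MvPolynomial.mem_restrictTotalDegree _ _ _).1 (w i).2) x₀
      (M.hT i) hh y (T_subset_closedBall hx₀ hy)
    have h2 : ∫ x in Metric.closedBall x₀ (σ * M.hT i), polyFun (w i).1 x * polyFun (w i).1 x ≤
        ∫ x in M.T i, val w i x * val w i x :=
      setIntegral_mono_set (integrableOn_T i (by fun_prop))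
        (Filter.Eventually.of_forall fun x => mul_self_nonneg _)
        (Filter.Eventually.of_forall hball)
    rw [hB, sq_abs]
    calc M.hT i ^ d * val w i y ^ 2 ≤ _ := h1
      _ ≤ C * (jumpL1 v i * |val w i y|) := by gcongr; exact h2.trans hsq
  intro x hx
  refine (mul_le_mul_of_nonneg_left (hmax' x hx) (by positivity)).trans ?_
  rcases hB0.eq_or_lt with h0 | h0
  · rw [← h0, mul_zero]
    exact mul_nonneg hC.le (jumpL1_nonneg v i)
  · refine le_of_mul_le_mul_right ?_ h0
    calc M.hT i ^ d * B * B = M.hT i ^ d * B ^ 2 := by ring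
      _ ≤ _ := hkey
      _ = _ := by ring

theorem add_rpow_le_two_rpow_mul {p a b : ℝ} (ha : 0 ≤ a) (hb : 0 ≤ b) (hp : 1 ≤ p) :
    (a + b) ^ p ≤ 2 ^ (p - 1) * (a ^ p + b ^ p) := by
  lift a to NNReal using ha
  lift b to NNReal using hb
  exact_mod_cast NNReal.rpow_add_le_mul_rpow_add_rpow a b hp

theorem norm_pwGrad_le (v : M.DGSpace k) (i : Fin M.n) (x : E d) {D : ℝ}
    (hD : ∀ l, |val (numDeriv l v - pwDeriv l v) i x| ≤ D) :
    ‖pwGrad v i x‖ ≤ ‖numGrad v i x‖ + d * D := by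
  have hsub : ∀ l, val (numDeriv l v - pwDeriv l v) i x = val (numDeriv l v) i x - dval l v i x := by
    intro l
    simp [val, dval, pwDeriv]
  have h1 : ‖numGrad v i x - pwGrad v i x‖ ≤ d * D := by
    have hdec : numGrad v i x - pwGrad v i x = ∑ l, EuclideanSpace.single l
        (val (numDeriv l v - pwDeriv l v) i x) := by
      ext m
      simp [numGrad, pwGrad, hsub, Pi.single_apply]
    rw [hdec]
    refine (norm_sum_le _ _).trans ?_
    simp only [PiLp.norm_single, Real.norm_eq_abs]
    refine (Finset.sum_le_card_nsmul _ _ D fun l _ => hD l).trans ?_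
    simp
  have h2 : ‖pwGrad v i x‖ ≤ ‖numGrad v i x‖ + ‖numGrad v i x - pwGrad v i x‖ := by
    rw [norm_sub_rev]
    exact norm_le_norm_add_norm_sub' _ _
  linarith

@[fun_prop]
theorem continuous_pwGrad (v : M.DGSpace k) (i : Fin M.n) : Continuous (pwGrad v i) := by
  unfold pwGrad
  fun_prop

@[fun_prop]
theorem continuous_numGrad (v : M.DGSpace k) (i : Fin M.n) : Continuous (numGrad v i) := by
  unfold numGrad
  fun_prop

theorem exists_integral_pwGrad_le (d k : ℕ) (hd : 1 ≤ d) {σ p : ℝ} (hσ : 0 < σ) (hp : 1 < p) :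
    ∃ C : ℝ, 0 < C ∧ ∀ (Ω : Set (E d)), interior (closure Ω) = Ω → ∀ M : Mesh Ω,
      M.ShapeRegular σ → ∀ (v : M.DGSpace k) (i : Fin M.n),
        ∫ x in M.T i, ‖pwGrad v i x‖ ^ p ≤ C * (∫ x in M.T i, ‖numGrad v i x‖ ^ p) +
          C * (M.hT i ^ (1 - p) * jumpLp p v i) := by
  obtain ⟨C, hC, hdef⟩ := exists_abs_defect_le d k hd hσ
  have hd0 : (0 : ℝ) < d := by exact_mod_cast hd
  set ω := volume.real (Metric.ball (0 : E d) 1) with hω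
  have hω0 : 0 < ω := by
    rw [hω, measureReal_def]
    exact ENNReal.toReal_pos (Metric.measure_ball_pos _ _ one_pos).ne' measure_ball_lt_top.ne
  -- From `σ h A ≤ d |T| ≤ d ω h ^ d` the interface area `A` is at most `K h ^ (d - 1)`, the value
  -- `a` used below.
  set K := d * ω / σ with hK
  have hK0 : 0 < K := by positivity
  have h2p : (0 : ℝ) < 2 ^ (p - 1) := Real.rpow_pos_of_pos two_pos _
  have hB0 : 0 < (d * C * K) ^ p * (ω / K) := by positivity
  refine ⟨2 ^ (p - 1) * (1 + (d * C * K) ^ p * (ω / K)), by positivity,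
    fun Ω hΩ M hM v i => ?_⟩
  have hh := hT_pos hd i
  set h := M.hT i with hh_def
  obtain ⟨x₀, hball⟩ := hM i
  have hx₀ : x₀ ∈ M.T i := hball (Metric.mem_closedBall_self (by positivity))
  have hvol : volume.real (M.T i) ≤ h ^ d * ω := volume_T_le hx₀
  set a := K * h ^ (d - 1) with ha
  have ha0 : 0 < a := by positivity
  have hpow : h ^ d = h ^ (d - 1) * h := by rw [← pow_succ, Nat.sub_add_cancel hd]
  have hA : interfaceArea M i ≤ a := by
    have h1 := mul_interfaceArea_le hΩ (by positivity) hball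
    have h2 : σ * h * interfaceArea M i ≤ σ * h * a := by
      refine h1.trans ((mul_le_mul_of_nonneg_left hvol hd0.le).trans (le_of_eq ?_))
      rw [ha, hK, hpow]
      field_simp
    exact le_of_mul_le_mul_left h2 (by positivity)
  have hJ := rpow_jumpL1_div_le hp v i ha0 hA
  set s := jumpL1 v i / a with hs
  have hs0 : 0 ≤ s := div_nonneg (jumpL1_nonneg v i) ha0.le
  have hS : jumpL1 v i = s * a := by rw [hs, div_mul_cancel₀ _ ha0.ne']
  -- The pointwise bound on the defect: `C J₁ / h ^ d` with `J₁ = s K h ^ (d - 1)`.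
  set D := C * K * s / h with hD
  have hD0 : 0 ≤ D := by positivity
  have hpt : ∀ x ∈ M.T i, ‖pwGrad v i x‖ ^ p ≤
      2 ^ (p - 1) * (‖numGrad v i x‖ ^ p + (d * D) ^ p) := by
    intro x hx
    have h1 : ‖pwGrad v i x‖ ≤ ‖numGrad v i x‖ + d * D := by
      refine norm_pwGrad_le v i x fun l => ?_
      have h2 := hdef Ω hΩ M hM v l i x hx
      refine le_of_mul_le_mul_left (h2.trans (le_of_eq ?_)) (show 0 < h ^ d by positivity)
      rw [hS, hD, ha, hpow]
      field_simp
    exact (Real.rpow_le_rpow (norm_nonneg _) h1 (by linarith)).trans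
      (add_rpow_le_two_rpow_mul (norm_nonneg _) (by positivity) hp.le)
  have hp0 : 0 ≤ p := by linarith
  have hi1 : IntegrableOn (fun x => ‖pwGrad v i x‖ ^ p) (M.T i) :=
    integrableOn_T i (Continuous.rpow_const (by fun_prop) fun _ => Or.inr hp0)
  have hi2 : IntegrableOn (fun x => ‖numGrad v i x‖ ^ p) (M.T i) :=
    integrableOn_T i (Continuous.rpow_const (by fun_prop) fun _ => Or.inr hp0)
  have hi3 : Integrable (fun _ : E d => (d * D) ^ p) (volume.restrict (M.T i)) :=
    integrableOn_const (isCompact_T i).measure_lt_top.ne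
  have hint : ∫ x in M.T i, ‖pwGrad v i x‖ ^ p ≤
      2 ^ (p - 1) * ((∫ x in M.T i, ‖numGrad v i x‖ ^ p) + (d * D) ^ p * volume.real (M.T i)) := by
    refine (setIntegral_mono_on hi1 ((hi2.add hi3).const_mul _)
      (isCompact_T i).isClosed.measurableSet hpt).trans (le_of_eq ?_)
    rw [integral_const_mul]
    congr 1
    refine (integral_add hi2 hi3).trans ?_
    simp [mul_comm]
  have hrem : (d * D) ^ p * volume.real (M.T i) ≤
      (d * C * K) ^ p * (ω / K) * (h ^ (1 - p) * jumpLp p v i) := by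
    have hDp : (d * D) ^ p = (d * C * K) ^ p * s ^ p * h ^ (-p) := by
      rw [hD, Real.rpow_neg hh.le, ← Real.mul_rpow (by positivity) hs0, ← div_eq_mul_inv,
        ← Real.div_rpow (by positivity) hh.le]
      congr 1
      ring
    have hh1 : h ^ (1 - p) = h ^ (-p) * h := by
      rw [← Real.rpow_add_one hh.ne']
      congr 1
      ring
    calc (d * D) ^ p * volume.real (M.T i) ≤ (d * D) ^ p * (h ^ d * ω) := by
          gcongr
      _ = (d * C * K) ^ p * (ω / K) * (h ^ (1 - p) * (s ^ p * a)) := by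
          rw [hDp, hh1, ha, hpow]
          field_simp
      _ ≤ _ := by gcongr
  have hX : 0 ≤ ∫ x in M.T i, ‖numGrad v i x‖ ^ p :=
    integral_nonneg fun x => Real.rpow_nonneg (norm_nonneg _) _
  have hY : 0 ≤ h ^ (1 - p) * jumpLp p v i :=
    mul_nonneg (Real.rpow_nonneg hh.le _) (jumpLp_nonneg p v i)
  refine hint.trans ?_
  rw [mul_assoc (2 ^ (p - 1)), mul_assoc (2 ^ (p - 1)), ← mul_add]
  refine mul_le_mul_of_nonneg_left ?_ h2p.le
  linarith [mul_nonneg hB0.le hX]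

/-! ### Edge sizes, summation over the mesh and conclusion -/

theorem hEdge_pos (hd : 1 ≤ d) {e : Fin M.n × Fin M.n} (he : e ∈ M.interiorEdges) :
    0 < M.hEdge e := by
  unfold hEdge
  split_ifs with h
  · exact lt_max_of_lt_left (hT_pos hd e.1)
  · refine Metric.diam_pos ?_ (isCompact_edge e).isBounded
    by_contra hnt
    have hpos : 0 < surface d (M.edge e) := by
      simp only [interiorEdges, Finset.mem_filter] at he
      exact he.2.2
    have hsub := not_nontrivial_iff.1 hnt
    -- For `d ≥ 2` the Hausdorff dimension `d - 1` is positive, so a point is null and an edge of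
    -- positive measure has positive diameter.
    have : NullSingletonClass (Measure.hausdorffMeasure ((d - 1 : ℕ) : ℝ) : Measure (E d)) :=
      Measure.nullSingletonClass_hausdorff _ (by exact_mod_cast (by omega : 0 < d - 1))
    rw [surface, Measure.euclideanHausdorffMeasure_def, Measure.smul_apply,
      hsub.measure_zero, smul_zero] at hpos
    exact hpos.false

theorem hEdge_le {τ : ℝ} (hd : 1 ≤ d) (hM : M.QuasiUniform τ) (e : Fin M.n × Fin M.n) :
    M.hEdge e ≤ max 1 τ * M.hT e.1 ∧ M.hEdge e ≤ max 1 τ * M.hT e.2 := by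
  have h1 := hT_pos hd e.1
  have h2 := hT_pos hd e.2
  have hle : ∀ i, M.hT i ≤ max 1 τ * M.hT i := fun i =>
    le_mul_of_one_le_left (hT_pos hd i).le (le_max_left _ _)
  have hqu : ∀ i j, M.hT i ≤ max 1 τ * M.hT j := fun i j =>
    (hM i j).trans (mul_le_mul_of_nonneg_right (le_max_right _ _) (hT_pos hd j).le)
  unfold hEdge
  split_ifs with h
  · exact ⟨max_le (hle _) (hqu _ _), max_le (hqu _ _) (hle _)⟩
  · exact ⟨(Metric.diam_mono inter_subset_left (isCompact_T e.1).isBounded).trans (hle _),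
      (Metric.diam_mono inter_subset_right (isCompact_T e.2).isBounded).trans (hle _)⟩

/-- As `1 - p < 0`, the bound `h_e ≤ max(1, τ) h_T` reverses into `h_T ^ (1 - p) ≤ max(1, τ) ^ (p -
1) h_e ^ (1 - p)`. The factor `2` counts the two sides of an edge, and `γ e > 1` lets the penalty be
inserted. -/
theorem sum_jumpLp_le {p τ : ℝ} (hp : 1 < p) (hd : 1 ≤ d) (hM : M.QuasiUniform τ)
    {γ : Fin M.n × Fin M.n → ℝ} (hγ : ∀ e ∈ M.interiorEdges, 1 < γ e) (v : M.DGSpace k) :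
    ∑ i, M.hT i ^ (1 - p) * jumpLp p v i ≤ 2 * (max 1 τ) ^ (p - 1) * ∑ e ∈ M.interiorEdges,
      ∫ x in M.edge e, γ e * M.hEdge e ^ (1 - p) * |jump v e x| ^ p ∂(surface d) := by
  have hm : 0 < max 1 τ := lt_max_of_lt_left one_pos
  have hsum : ∑ i, M.hT i ^ (1 - p) * jumpLp p v i = ∑ e ∈ M.interiorEdges,
      (M.hT e.1 ^ (1 - p) + M.hT e.2 ^ (1 - p)) *
        ∫ x in M.edge e, |jump v e x| ^ p ∂(surface d) := by
    have h := sum_integral_edge (M := M)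
      fun i j x => M.hT i ^ (1 - p) * |val v i x - val v j x| ^ p
    simp only [integral_const_mul, ← Finset.mul_sum] at h
    refine h.trans (Finset.sum_congr rfl fun e _ => ?_)
    simp only [abs_sub_comm (val v e.2 _)]
    rw [← add_mul]
    rfl
  rw [hsum, Finset.mul_sum]
  refine Finset.sum_le_sum fun e he => ?_
  have he0 := hEdge_pos hd he
  have hI : 0 ≤ ∫ x in M.edge e, |jump v e x| ^ p ∂(surface d) :=
    integral_nonneg fun x => Real.rpow_nonneg (abs_nonneg _) _
  have hone : ∀ i, M.hEdge e ≤ max 1 τ * M.hT i →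
      M.hT i ^ (1 - p) ≤ (max 1 τ) ^ (p - 1) * M.hEdge e ^ (1 - p) := by
    intro i hi
    have h1 : M.hEdge e / max 1 τ ≤ M.hT i := by rwa [div_le_iff₀' hm]
    refine (Real.rpow_le_rpow_of_nonpos (div_pos he0 hm) h1 (by linarith)).trans (le_of_eq ?_)
    rw [Real.div_rpow he0.le hm.le, div_eq_mul_inv, ← Real.rpow_neg hm.le, neg_sub, mul_comm]
  obtain ⟨h1, h2⟩ := hEdge_le hd hM e
  have hc0 : 0 ≤ (max 1 τ) ^ (p - 1) * M.hEdge e ^ (1 - p) := by positivity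
  rw [integral_const_mul]
  calc (M.hT e.1 ^ (1 - p) + M.hT e.2 ^ (1 - p)) *
        ∫ x in M.edge e, |jump v e x| ^ p ∂(surface d)
      ≤ (2 * ((max 1 τ) ^ (p - 1) * M.hEdge e ^ (1 - p))) *
        ∫ x in M.edge e, |jump v e x| ^ p ∂(surface d) := by
        gcongr
        linarith [hone _ h1, hone _ h2]
    _ ≤ γ e * ((2 * ((max 1 τ) ^ (p - 1) * M.hEdge e ^ (1 - p))) *
        ∫ x in M.edge e, |jump v e x| ^ p ∂(surface d)) :=
        le_mul_of_one_le_left (by positivity) (hγ e he).le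
    _ = _ := by ring

end Mesh

end DGCalc

end

theorem mainTheorem4 (d : ℕ) (hd : 1 ≤ d) (k : ℕ) (p : ℝ) (hp : 1 < p)
    (Ω : Set (DGCalc.E d)) (hΩ : DGCalc.IsPolygonalDomain Ω) (σ τ : ℝ) (hσ : 0 < σ) :
    ∃ C γstar : ℝ, 0 < C ∧ 0 < γstar ∧
      ∀ M : DGCalc.Mesh Ω, M.ShapeRegular σ → M.QuasiUniform τ →
        ∀ γ : Fin M.n × Fin M.n → ℝ, (∀ e ∈ M.interiorEdges, γstar < γ e) →
          ∀ v : M.DGSpace k,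
            DGCalc.Mesh.brokenSeminorm p γ v ≤
              C * DGCalc.Mesh.lpNorm p (DGCalc.Mesh.numGrad v)
                + C * DGCalc.Mesh.jumpTerm p γ v := by
  obtain ⟨A, hA, hloc⟩ := DGCalc.Mesh.exists_integral_pwGrad_le d k hd hσ hp
  set B := A * (2 * (max 1 τ) ^ (p - 1)) with hB
  have hm : 0 < max 1 τ := lt_max_of_lt_left one_pos
  have hB0 : 0 < B := by positivity
  -- The first two summands come from the gradient, the `1` absorbs the jump term of the seminorm.
  -- Neither `A` nor `B` depends on `Ω`.
  refine ⟨A ^ (1 / p) + B ^ (1 / p) + 1, 1, by positivity, one_pos, fun M hS hQ γ hγ v => ?_⟩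
  have hp0 : 0 < p := by linarith
  set X := ∑ i, ∫ x in M.T i, ‖DGCalc.Mesh.numGrad v i x‖ ^ p with hX
  set Y := ∑ e ∈ M.interiorEdges, ∫ x in M.edge e,
    γ e * M.hEdge e ^ (1 - p) * |DGCalc.Mesh.jump v e x| ^ p ∂(DGCalc.surface d) with hY
  have hX0 : 0 ≤ X := Finset.sum_nonneg fun i _ =>
    integral_nonneg fun x => Real.rpow_nonneg (norm_nonneg _) _
  have hY0 : 0 ≤ Y := Finset.sum_nonneg fun e he => integral_nonneg fun x =>
    mul_nonneg (mul_nonneg (one_pos.trans (hγ e he)).le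
      (Real.rpow_nonneg (DGCalc.Mesh.hEdge_pos hd he).le _)) (Real.rpow_nonneg (abs_nonneg _) _)
  have hZ0 : 0 ≤ ∑ i, ∫ x in M.T i, ‖DGCalc.Mesh.pwGrad v i x‖ ^ p := Finset.sum_nonneg fun i _ =>
    integral_nonneg fun x => Real.rpow_nonneg (norm_nonneg _) _
  have hsum : ∑ i, ∫ x in M.T i, ‖DGCalc.Mesh.pwGrad v i x‖ ^ p ≤ A * X + B * Y := by
    calc ∑ i, ∫ x in M.T i, ‖DGCalc.Mesh.pwGrad v i x‖ ^ p
        ≤ ∑ i, (A * (∫ x in M.T i, ‖DGCalc.Mesh.numGrad v i x‖ ^ p) +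
          A * (M.hT i ^ (1 - p) * DGCalc.Mesh.jumpLp p v i)) :=
          Finset.sum_le_sum fun i _ => hloc Ω hΩ.interior_closure M hS v i
      _ = A * X + A * ∑ i, M.hT i ^ (1 - p) * DGCalc.Mesh.jumpLp p v i := by
          rw [Finset.sum_add_distrib, Finset.mul_sum, Finset.mul_sum]
      _ ≤ A * X + A * (2 * (max 1 τ) ^ (p - 1) * Y) := by
          gcongr
          exact DGCalc.Mesh.sum_jumpLp_le hp hd hQ hγ v
      _ = A * X + B * Y := by rw [hB]; ring
  have hgrad : DGCalc.Mesh.lpNorm p (DGCalc.Mesh.pwGrad v) ≤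
      A ^ (1 / p) * X ^ (1 / p) + B ^ (1 / p) * Y ^ (1 / p) := by
    rw [← Real.mul_rpow hA.le hX0, ← Real.mul_rpow hB0.le hY0]
    refine (Real.rpow_le_rpow hZ0 hsum (by positivity)).trans ?_
    -- Subadditivity of `t ↦ t ^ (1 / p)`, valid because `1 / p ≤ 1`.
    exact Real.rpow_add_le_add_rpow (by positivity) (by positivity) (by positivity)
      ((div_le_one hp0).2 hp.le)
  have hX1 : 0 ≤ X ^ (1 / p) := Real.rpow_nonneg hX0 _
  have hY1 : 0 ≤ Y ^ (1 / p) := Real.rpow_nonneg hY0 _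
  have hA1 : 0 ≤ A ^ (1 / p) := Real.rpow_nonneg hA.le _
  have hB1 : 0 ≤ B ^ (1 / p) := Real.rpow_nonneg hB0.le _
  change DGCalc.Mesh.lpNorm p (DGCalc.Mesh.pwGrad v) + Y ^ (1 / p) ≤
    _ * X ^ (1 / p) + _ * Y ^ (1 / p)
  nlinarith [mul_nonneg hA1 hY1, mul_nonneg hB1 hX1]
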